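/- Let $\mathcal X$ be a set, $x_1,\dots,x_n\in\mathcal X$ fixed design points, and write $\|f\|_n^2=\frac1n\sum_{i=1}^n f(x_i)^2$ for $f:\mathcal X\to\mathbb R$. Let $\mathcal F$ be a convex class of real functions on $\mathcal X$ and $B(f,t)=\{g\in\mathcal F:\|g-f\|_n\le t\}$. Let $\mathcal N(\epsilon,\mathcal G)$ be the least cardinality of a set of functions that meets the $\|\cdot\|_n$-ball of radius $\epsilon$ around each element of $\mathcal G$, and let $\bar{\mathcal W}(\mathcal G)=\mathbb E\sup_{f\in\mathcal G}\frac1n\sum_{i=1}^n g_if(x_i)$ with $g_1,\dots,g_n$ i.i.d. $N(0,1)$. The data are $Y_i=f^*(x_i)+\xi_i$ with $f^*\in\mathcal F$ and $\xi_i$ i.i.d. $N(0,1)$, and $\hat f_n\in\operatorname{argmin}_{f\in\mathcal F}\sum_{i=1}^n(Y_i-f(x_i))^2$ is a least squares estimator (assumed to exist for all data). Theorem. Let $p>2$ and let $c_1,C_1,C_2,C_3,C_4>0$. There are constants $a,c>0$, depending only on $p,c_1,C_1,C_2,C_3,C_4$, such that for all $\beta,\gamma\ge0$ and $\epsilon_0>0$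 there is $n_0$ (depending on all the preceding quantities) with the following property. Put $s=\frac\gamma2\left(\frac p2-1\right)$. Let $n\ge n_0$, and let $\mathcal X$, $x_1,\dots,x_n$, $\mathcal F$, $\hat f_n$ be as above. Suppose that there are $f_0,f_{(n)}\in\mathcal F$ such that (i) $\log\mathcal N(\epsilon,B(f_0,2\epsilon))\ge c_1\epsilon^{-p}$ whenever $C_1n^{-1/p}(\log n)^{\gamma}\le\epsilon\le\epsilon_0$; (ii) $\|f_{(n)}-f_0\|_n\le C_2\,n^{-\frac1{2p}}(\log n)^{-s}$; (iii) either $$\log\mathcal N(\epsilon,B(f_{(n)},t))\le C_3\sqrt n\,(\log n)^{ps}\left(\log\tfrac1\epsilon\right)^{\beta}\left(\tfrac t\epsilon\right)^p$$ whenever $a\,n^{-\frac1p}(\log n)^{-2s}\le\epsilon\le t\le C_4\,n^{-\frac1{2p}}(\log n)^{-\frac\beta p-3s}$, or $$\bar{\mathcal W}(B(f_{(n)},t))\le C_3\,n^{-\frac1{2p}}(\log n)^{\frac\beta p+s}\,t$$ for some $t$ with $0<t\le a\,n^{-\frac1{2p}}(\log n)^{-\frac\beta p-3s}$. Then $$\sup_{f^*\in\mathcal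 F}\mathbb E_{f^*}\|\hat f_n-f^*\|_n^2\ \ge\ c\,n^{-\frac1p}(\log n)^{-\frac{2\beta}p-6s}.$$ -/

import Mathlib

open MeasureTheory ProbabilityTheory
open scoped ENNReal

noncomputable section

/-- The empirical `L²` seminorm `‖f‖ = ((1/n) ∑ᵢ f(xᵢ)²)^{1/2}` of a function `f` on `𝒳`, for the
uniform distribution on the design points `x₁, …, xₙ`. -/
def empNorm {𝒳 : Type*} {n : ℕ} (x : Fin n → 𝒳) (f : 𝒳 → ℝ) : ℝ :=
  Real.sqrt ((1 / (n : ℝ)) * ∑ i, (f (x i)) ^ 2)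

/-- The closed ball of radius `t` around `f₀` in the class `F`, for the empirical seminorm. -/
def empBall {𝒳 : Type*} {n : ℕ} (x : Fin n → 𝒳) (F : Set (𝒳 → ℝ)) (f₀ : 𝒳 → ℝ) (t : ℝ) :
    Set (𝒳 → ℝ) :=
  {f | f ∈ F ∧ empNorm x (f - f₀) ≤ t}

/-- The `ε`-covering number of `G` for the empirical seminorm: the least cardinality of a set of
functions (not necessarily members of `G`) within distance `ε` of every element of `G`. -/
def empCoveringNumber {𝒳 : Type*} {n : ℕ} (x : Fin n → 𝒳) (ε : ℝ) (G : Set (𝒳 → ℝ)) : ℕ∞ :=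
  ⨅ (N : Set (𝒳 → ℝ)) (_ : ∀ g ∈ G, ∃ g' ∈ N, empNorm x (g - g') ≤ ε), N.encard

/-- The metric entropy, the logarithm of the covering number (with `log 0 = ⊥`, `log ∞ = ⊤`). -/
def empEntropy {𝒳 : Type*} {n : ℕ} (x : Fin n → 𝒳) (ε : ℝ) (G : Set (𝒳 → ℝ)) : EReal :=
  ENNReal.log (empCoveringNumber x ε G : ℝ≥0∞)

/-- The law of `n` independent standard normal variables. -/
def stdNormal (n : ℕ) : Measure (Fin n → ℝ) :=
  Measure.pi fun _ => gaussianReal 0 1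

/-- The Gaussian width `𝔼 sup_{f ∈ G} (1/n) ∑ᵢ gᵢ f(xᵢ)`. It is only used for sets `G` that are
nonempty and bounded in the empirical seminorm; there the supremum is finite for every `g`, and a
continuous, integrable function of `g`. -/
def gaussianWidth {𝒳 : Type*} {n : ℕ} (x : Fin n → 𝒳) (G : Set (𝒳 → ℝ)) : ℝ :=
  ∫ g, sSup ((fun f : 𝒳 → ℝ => (1 / (n : ℝ)) * ∑ i, g i * f (x i)) '' G) ∂(stdNormal n)

/-- `fhat` is a least squares estimator over `F`: it maps each data vector `y` to a minimizer of
`∑ᵢ (yᵢ - f(xᵢ))²` over `f ∈ F`. -/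
def IsLeastSquaresEstimator {𝒳 : Type*} {n : ℕ} (x : Fin n → 𝒳) (F : Set (𝒳 → ℝ))
    (fhat : (Fin n → ℝ) → (𝒳 → ℝ)) : Prop :=
  ∀ y : Fin n → ℝ, fhat y ∈ F ∧
    ∀ f ∈ F, ∑ i, (y i - fhat y (x i)) ^ 2 ≤ ∑ i, (y i - f (x i)) ^ 2

/-- The worst-case risk `sup_{f ∈ F} 𝔼 ‖fhat(Y) - f‖²` over the model `Yᵢ = f(xᵢ) + ξᵢ` with
independent standard normal noise `ξ₁, …, ξₙ`. -/
def worstCaseRisk {𝒳 : Type*} {n : ℕ} (x : Fin n → 𝒳) (F : Set (𝒳 → ℝ))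
    (fhat : (Fin n → ℝ) → (𝒳 → ℝ)) : ℝ≥0∞ :=
  ⨆ f ∈ F, ∫⁻ ξ, ENNReal.ofReal
    ((empNorm x (fhat (fun i => f (x i) + ξ i) - f)) ^ 2) ∂(stdNormal n)

/-- The exponent `s = (γ/2)(p/2 - 1)` of the logarithmic factors. -/
def sExp (p γ : ℝ) : ℝ := γ / 2 * (p / 2 - 1)

/-- The function `n^u (log n)^v`. -/
def rate (n : ℕ) (u v : ℝ) : ℝ := (n : ℝ) ^ u * Real.log n ^ v

end

/-! Take the truth to be `f₁ = f_(n)`. Least squares then maximises `⟨g, f - f₁⟩ - ‖f - f₁‖²/2` over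
`F`, where `⟨g, ·⟩` is the empirical pairing with the noise. The bad point is one that is close to a
rich region of `F` but has a simple neighbourhood of its own.

Let `r = n^(-1/p) (log n)^(-2s)`. At the scale `ε` of order `n^(-1/p) (log n)^γ`, the packing near
`f₀` produces, with probability at least `3/4`, some `f ∈ F` whose pairing with the noise is of
order `r`, at a distance `D` from `f₁` with `D²` of order `r` too (`exists_event_large_pairing`).
This is a Sudakov bound in probability; it comes from a testing argument with shifted Gaussians.
Convexity allows `f` to be contracted towards `f₁`, which makes the linear gain beat the quadratic
penalty, so the maximum of the objective is at least `κ r`.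

In a ball of radius of order `τ = n^(-1/(2p)) (log n)^(-β/p - 3s)` around `f₁`, the pairing has
expected supremum at most `κ r / 4`, by truncated chaining or by rescaling the Gaussian width. By
Markov the estimator leaves this ball with probability at least `1/2`, so its risk is at least of
order `τ²` (`le_worstCaseRisk`).

Suprema over balls are handled through integrable majorants `Z`, which avoids measurability
questions about the suprema and about the estimator. -/

/-- The empirical pairing `(1/n) ∑ᵢ gᵢ f(xᵢ)` of a noise vector with a function. -/
noncomputable def empPairing {𝒳 : Type*} {n : ℕ} (x : Fin n → 𝒳) (g : Fin n → ℝ) (f : 𝒳 → ℝ) : ℝ :=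
  (1 / (n : ℝ)) * ∑ i, g i * f (x i)

/-! ### Algebra of the empirical seminorm and pairing -/

section Seminorm

variable {𝒳 : Type*} {n : ℕ} (x : Fin n → 𝒳)

lemma empNorm_nonneg (f : 𝒳 → ℝ) : 0 ≤ empNorm x f := Real.sqrt_nonneg _

lemma empNorm_sq (f : 𝒳 → ℝ) : empNorm x f ^ 2 = (1 / (n : ℝ)) * ∑ i, (f (x i)) ^ 2 :=
  Real.sq_sqrt (by positivity)

lemma empNorm_eq_norm (f : 𝒳 → ℝ) :
    empNorm x f = Real.sqrt (1 / (n : ℝ)) * ‖WithLp.toLp 2 (fun i => f (x i))‖ := by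
  rw [empNorm, EuclideanSpace.norm_eq, Real.sqrt_mul (by positivity)]
  simp

lemma empNorm_add_le (f g : 𝒳 → ℝ) : empNorm x (f + g) ≤ empNorm x f + empNorm x g := by
  simp only [empNorm_eq_norm, ← mul_add]
  gcongr
  exact norm_add_le (WithLp.toLp 2 fun i => f (x i)) (WithLp.toLp 2 fun i => g (x i))

lemma empNorm_smul (c : ℝ) (f : 𝒳 → ℝ) : empNorm x (c • f) = |c| * empNorm x f := by
  have := norm_smul c (WithLp.toLp 2 fun i => f (x i))
  rw [Real.norm_eq_abs] at this
  rw [empNorm_eq_norm, empNorm_eq_norm, mul_left_comm, ← this]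
  rfl

lemma empNorm_sub_comm (f g : 𝒳 → ℝ) : empNorm x (f - g) = empNorm x (g - f) := by
  simp only [empNorm, Pi.sub_apply]
  congr 3 with i
  ring

lemma empNorm_sub_le (f g h : 𝒳 → ℝ) :
    empNorm x (f - h) ≤ empNorm x (f - g) + empNorm x (g - h) := by
  simpa using empNorm_add_le x (f - g) (g - h)

@[simp] lemma empNorm_zero : empNorm x (0 : 𝒳 → ℝ) = 0 := by simp [empNorm]

lemma empPairing_add (g : Fin n → ℝ) (f h : 𝒳 → ℝ) :
    empPairing x g (f + h) = empPairing x g f + empPairing x g h := by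
  simp [empPairing, mul_add, Finset.sum_add_distrib]

lemma empPairing_sub (g : Fin n → ℝ) (f h : 𝒳 → ℝ) :
    empPairing x g (f - h) = empPairing x g f - empPairing x g h := by
  simp [empPairing, mul_sub, Finset.sum_sub_distrib]

lemma empPairing_smul (g : Fin n → ℝ) (c : ℝ) (f : 𝒳 → ℝ) :
    empPairing x g (c • f) = c * empPairing x g f := by
  simp only [empPairing, Pi.smul_apply, smul_eq_mul, Finset.mul_sum]
  exact Finset.sum_congr rfl fun i _ => by ring

@[simp] lemma empPairing_zero (g : Fin n → ℝ) : empPairing x g (0 : 𝒳 → ℝ) = 0 := by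
  simp [empPairing]

/-- Cauchy–Schwarz. In `empNorm id g` the noise vector is a function on `Fin n`, with the identity
as design. -/
lemma empPairing_le (g : Fin n → ℝ) (f : 𝒳 → ℝ) :
    empPairing x g f ≤ empNorm id g * empNorm x f := by
  rw [empPairing, empNorm, empNorm, Real.sqrt_mul (by positivity), Real.sqrt_mul (by positivity),
    mul_mul_mul_comm, Real.mul_self_sqrt (by positivity)]
  gcongr
  exact Real.sum_mul_le_sqrt_mul_sqrt _ _ _

@[fun_prop] lemma continuous_empPairing (f : 𝒳 → ℝ) : Continuous fun g => empPairing x g f := by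
  unfold empPairing
  fun_prop

end Seminorm

/-! ### Sub-Gaussian tails and moments of the noise -/

instance (n : ℕ) : IsProbabilityMeasure (stdNormal n) := by
  unfold stdNormal
  infer_instance

lemma hasSubgaussianMGF_gaussianReal (b : ℝ) :
    HasSubgaussianMGF (fun y => b * y) (b ^ 2).toNNReal (gaussianReal 0 1) := by
  refine ⟨fun t => ?_, fun t => ?_⟩
  · simp only [← mul_assoc]
    exact integrable_exp_mul_gaussianReal _
  · have h := congrFun (mgf_id_gaussianReal (μ := 0) (v := 1)) (t * b)
    simp only [mgf, id] at h
    simp only [mgf, ← mul_assoc]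
    rw [h, Real.coe_toNNReal _ (sq_nonneg b)]
    refine (congrArg Real.exp ?_).le
    push_cast
    ring

section Gaussian

variable {𝒳 : Type*} {n : ℕ} (x : Fin n → 𝒳)

lemma hasSubgaussianMGF_empPairing (f : 𝒳 → ℝ) :
    HasSubgaussianMGF (fun g => empPairing x g f) (empNorm x f ^ 2 / n).toNNReal (stdNormal n) := by
  have hind : iIndepFun (fun (i : Fin n) (g : Fin n → ℝ) => (f (x i) / n) * g i) (stdNormal n) :=
    iIndepFun_pi (μ := fun _ : Fin n => gaussianReal 0 1)
      (X := fun i y => (f (x i) / n) * y) (fun i => by fun_prop)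
  have := HasSubgaussianMGF.sum_of_iIndepFun hind (s := Finset.univ)
    (c := fun i => ((f (x i) / n) ^ 2).toNNReal) (fun i _ => by
      have h := hasSubgaussianMGF_gaussianReal (f (x i) / n)
      rw [← (measurePreserving_eval (fun _ : Fin n => gaussianReal 0 1) i).map_eq] at h
      exact h.of_map (measurable_pi_apply i).aemeasurable)
  convert this using 1
  · ext g
    simp only [empPairing, Finset.mul_sum]
    exact Finset.sum_congr rfl fun i _ => by ring
  · rw [← Real.toNNReal_sum_of_nonneg (fun i _ => sq_nonneg _), empNorm_sq]
    congr 1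
    rw [Finset.mul_sum, Finset.sum_div]
    exact Finset.sum_congr rfl fun i _ => by ring

lemma integral_exp_empPairing_le (f : 𝒳 → ℝ) (t : ℝ) :
    ∫ g, Real.exp (t * empPairing x g f) ∂(stdNormal n) ≤
      Real.exp (t ^ 2 * (empNorm x f ^ 2 / n) / 2) := by
  have := (hasSubgaussianMGF_empPairing x f).mgf_le t
  rw [Real.coe_toNNReal _ (by positivity)] at this
  rwa [mul_comm (t ^ 2)]

lemma integrable_exp_empPairing (f : 𝒳 → ℝ) (t : ℝ) :
    Integrable (fun g => Real.exp (t * empPairing x g f)) (stdNormal n) :=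
  (hasSubgaussianMGF_empPairing x f).integrable_exp_mul t

lemma integrable_empPairing (f : 𝒳 → ℝ) :
    Integrable (fun g => empPairing x g f) (stdNormal n) :=
  (hasSubgaussianMGF_empPairing x f).integrable

lemma integral_empPairing (f : 𝒳 → ℝ) : ∫ g, empPairing x g f ∂(stdNormal n) = 0 := by
  unfold empPairing stdNormal
  rw [integral_const_mul, integral_finsetSum]
  · simp only [integral_mul_const]
    have (i : Fin n) : ∫ g : Fin n → ℝ, g i ∂(Measure.pi fun _ => gaussianReal 0 1) = 0 := by
      rw [integral_eval]
      exact integral_id_gaussianReal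
    simp [this]
  · intro i _
    refine Integrable.mul_const (integrable_eval (μ := fun _ : Fin n => gaussianReal 0 1) (i := i) ?_) _
    exact (memLp_id_gaussianReal 1).integrable (by simp)

lemma measureReal_empPairing_ge_le (f : 𝒳 → ℝ) {η : ℝ} (hη : 0 ≤ η) :
    (stdNormal n).real {g | η ≤ empPairing x g f} ≤
      Real.exp (-η ^ 2 / (2 * (empNorm x f ^ 2 / n))) := by
  have := (hasSubgaussianMGF_empPairing x f).measure_ge_le hη
  rwa [Real.coe_toNNReal _ (by positivity)] at this

lemma integrable_sq_eval (i : Fin n) : Integrable (fun g : Fin n → ℝ => g i ^ 2) (stdNormal n) := by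
  refine integrable_comp_eval (μ := fun _ : Fin n => gaussianReal 0 1) (i := i) (f := fun y => y ^ 2) ?_
  exact (memLp_id_gaussianReal 2).integrable_sq

lemma integral_sq_eval (i : Fin n) : ∫ g : Fin n → ℝ, g i ^ 2 ∂(stdNormal n) = 1 := by
  unfold stdNormal
  rw [integral_comp_eval (μ := fun _ : Fin n => gaussianReal 0 1) (i := i) (f := fun y => y ^ 2)
    (by fun_prop)]
  have h := variance_id_gaussianReal (μ := 0) (v := 1)
  rw [variance_of_integral_eq_zero (by fun_prop) (by simp)] at h
  simpa using h

lemma integrable_empNorm_id_sq :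
    Integrable (fun g : Fin n → ℝ => empNorm id g ^ 2) (stdNormal n) := by
  simp only [empNorm_sq, id]
  exact (integrable_finsetSum _ fun i _ => integrable_sq_eval i).const_mul _

lemma integral_empNorm_id_sq_le :
    ∫ g : Fin n → ℝ, empNorm id g ^ 2 ∂(stdNormal n) ≤ 1 := by
  simp only [empNorm_sq, id]
  rw [integral_const_mul, integral_finsetSum _ fun i _ => integrable_sq_eval i]
  simp only [integral_sq_eval]
  simp only [Finset.sum_const, Finset.card_univ, Fintype.card_fin, nsmul_eq_mul, mul_one, one_div]
  exact inv_mul_le_one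

end Gaussian

/-! ### Gaussian shifts and the testing argument -/

lemma gaussianReal_eq_withDensity (b : ℝ) :
    gaussianReal b 1 =
      (gaussianReal 0 1).withDensity fun y => ENNReal.ofReal (Real.exp (b * y - b ^ 2 / 2)) := by
  rw [gaussianReal_of_var_ne_zero _ one_ne_zero, gaussianReal_of_var_ne_zero _ one_ne_zero,
    ← withDensity_mul _ (measurable_gaussianPDF _ _) (by fun_prop)]
  congr 1
  ext y
  simp only [gaussianPDF, Pi.mul_apply]
  rw [← ENNReal.ofReal_mul (gaussianPDFReal_nonneg _ _ _)]
  simp only [gaussianPDFReal]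
  rw [mul_assoc _ (Real.exp _) (Real.exp _), ← Real.exp_add]
  congr 3
  push_cast
  ring

lemma lintegral_stdNormal_prod {n : ℕ} (f : Fin n → ℝ → ℝ≥0∞) (hf : ∀ i, Measurable (f i)) :
    ∫⁻ y, ∏ i, f i (y i) ∂(stdNormal n) = ∏ i, ∫⁻ y, f i y ∂(gaussianReal 0 1) := by
  have hind : iIndepFun (fun (i : Fin n) (g : Fin n → ℝ) => f i (g i)) (stdNormal n) :=
    iIndepFun_pi (μ := fun _ : Fin n => gaussianReal 0 1) (X := f) fun i => (hf i).aemeasurable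
  rw [lintegral_prod_eq_prod_lintegral_of_indepFun _ _ hind fun i => by fun_prop]
  refine Finset.prod_congr rfl fun i _ => ?_
  exact (measurePreserving_eval (fun _ : Fin n => gaussianReal 0 1) i).lintegral_comp (hf i)

/-- The likelihood ratio of the standard normal law shifted by `h`. -/
noncomputable def gaussianShiftDensity {n : ℕ} (h y : Fin n → ℝ) : ℝ≥0∞ :=
  ∏ i, ENNReal.ofReal (Real.exp (h i * y i - h i ^ 2 / 2))

lemma measurable_gaussianShiftDensity {n : ℕ} (h : Fin n → ℝ) :
    Measurable (gaussianShiftDensity h) := by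
  unfold gaussianShiftDensity
  fun_prop

lemma stdNormal_map_add {n : ℕ} (h : Fin n → ℝ) :
    (stdNormal n).map (fun g => g + h) = (stdNormal n).withDensity (gaussianShiftDensity h) := by
  have h1 : (stdNormal n).map (fun g => g + h) = Measure.pi fun i => gaussianReal (h i) 1 := by
    have := Measure.pi_map_pi (μ := fun _ : Fin n => gaussianReal 0 1)
      (f := fun i y => y + h i) (fun i => by fun_prop)
    simp only [gaussianReal_map_add_const, zero_add] at this
    exact this
  rw [h1]
  refine Measure.pi_eq fun s hs => ?_
  rw [withDensity_apply _ (MeasurableSet.univ_pi hs),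
    ← lintegral_indicator (MeasurableSet.univ_pi hs)]
  have h2 (y : Fin n → ℝ) : (Set.univ.pi s).indicator (gaussianShiftDensity h) y =
      ∏ i, (s i).indicator (fun y => ENNReal.ofReal (Real.exp (h i * y - h i ^ 2 / 2))) (y i) := by
    by_cases hy : ∀ i, y i ∈ s i
    · rw [Set.indicator_of_mem (by simpa using hy)]
      exact Finset.prod_congr rfl fun i _ => by rw [Set.indicator_of_mem (hy i)]
    · rw [Set.indicator_of_notMem (by simpa using hy)]
      push Not at hy
      obtain ⟨i, hi⟩ := hy
      exact (Finset.prod_eq_zero (Finset.mem_univ i) (Set.indicator_of_notMem hi _)).symm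
  simp only [h2]
  rw [lintegral_stdNormal_prod _ fun i => Measurable.indicator (by fun_prop) (hs i)]
  refine Finset.prod_congr rfl fun i _ => ?_
  rw [lintegral_indicator (hs i), gaussianReal_eq_withDensity (h i),
    withDensity_apply _ (hs i)]

lemma lintegral_gaussianShiftDensity_sq {n : ℕ} (h : Fin n → ℝ) :
    ∫⁻ y, gaussianShiftDensity h y ^ 2 ∂(stdNormal n) =
      ENNReal.ofReal (Real.exp (∑ i, h i ^ 2)) := by
  simp only [gaussianShiftDensity, ← Finset.prod_pow]
  rw [lintegral_stdNormal_prod (fun i y => ENNReal.ofReal (Real.exp (h i * y - h i ^ 2 / 2)) ^ 2)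
    fun i => by fun_prop, Real.exp_sum, ENNReal.ofReal_prod_of_nonneg fun i _ => by positivity]
  refine Finset.prod_congr rfl fun i _ => ?_
  have h1 (y : ℝ) : ENNReal.ofReal (Real.exp (h i * y - h i ^ 2 / 2)) ^ 2 =
      ENNReal.ofReal (Real.exp (-h i ^ 2) * Real.exp (2 * h i * y)) := by
    rw [← ENNReal.ofReal_pow (by positivity), ← Real.exp_nat_mul, ← Real.exp_add]
    congr 2
    push_cast
    ring
  simp only [h1]
  have h2 : Integrable (fun y => Real.exp (2 * h i * y)) (gaussianReal 0 1) :=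
    integrable_exp_mul_gaussianReal _
  rw [← ofReal_integral_eq_lintegral_ofReal (h2.const_mul _) (ae_of_all _ fun y => by positivity),
    integral_const_mul]
  have h3 := congrFun (mgf_id_gaussianReal (μ := 0) (v := 1)) (2 * h i)
  simp only [mgf, id] at h3
  rw [h3, ← Real.exp_add]
  congr 2
  push_cast
  ring

/-- Cauchy–Schwarz applied to the Cameron–Martin density, whose second moment is `exp (∑ h²)`. -/
lemma stdNormal_shift_le {n : ℕ} (h : Fin n → ℝ) {A : Set (Fin n → ℝ)} (hA : MeasurableSet A) :
    (stdNormal n).real {g | g + h ∈ A} ≤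
      Real.exp ((∑ i, h i ^ 2) / 2) * Real.sqrt ((stdNormal n).real A) := by
  have h0 : stdNormal n {g | g + h ∈ A} = ∫⁻ y in A, gaussianShiftDensity h y ∂(stdNormal n) := by
    rw [← withDensity_apply _ hA, ← stdNormal_map_add, Measure.map_apply (by fun_prop) hA]
    rfl
  have h1 : stdNormal n {g | g + h ∈ A} ≤
      ENNReal.ofReal (Real.exp (∑ i, h i ^ 2)) ^ (1 / 2 : ℝ) * stdNormal n A ^ (1 / 2 : ℝ) := by
    rw [h0, ← lintegral_gaussianShiftDensity_sq]
    have := ENNReal.lintegral_mul_le_Lp_mul_Lq ((stdNormal n).restrict A)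
      Real.HolderConjugate.two_two (measurable_gaussianShiftDensity h).aemeasurable
      (g := fun _ => 1) aemeasurable_const
    simp only [Pi.mul_apply, mul_one, lintegral_const, Measure.restrict_apply_univ,
      ENNReal.rpow_two, one_pow, one_mul] at this
    refine this.trans ?_
    gcongr
    exact Measure.restrict_le_self
  have h2 := ENNReal.toReal_mono (by finiteness) h1
  rw [ENNReal.toReal_mul, ← ENNReal.toReal_rpow, ← ENNReal.toReal_rpow,
    ENNReal.toReal_ofReal (by positivity), ← Real.exp_mul, ← Real.sqrt_eq_rpow] at h2
  simpa only [mul_one_div, measureReal_def] using h2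

/-- No test distinguishes many short shifts: otherwise every `A j` would have unshifted probability
above `1 / card ι`, which disjointness forbids. -/
lemma exists_stdNormal_shift_le {n : ℕ} {ι : Type*} [Fintype ι] [Nonempty ι]
    (h : ι → Fin n → ℝ) {R : ℝ} (hR : ∀ j, ∑ i, h j i ^ 2 ≤ R)
    (A : ι → Set (Fin n → ℝ)) (hA : ∀ j, MeasurableSet (A j))
    (hdisj : Pairwise (Function.onFun Disjoint A)) :
    ∃ j, (stdNormal n).real {g | g + h j ∈ A j} ≤
      Real.exp (R / 2) / Real.sqrt (Fintype.card ι) := by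
  by_contra! hcon
  have hm : (0 : ℝ) < Fintype.card ι := by exact_mod_cast Fintype.card_pos
  have h1 (j : ι) : 1 / Real.sqrt (Fintype.card ι) < Real.sqrt ((stdNormal n).real (A j)) := by
    have h2 := (hcon j).trans_le (stdNormal_shift_le (h j) (hA j))
    have h3 : Real.exp ((∑ i, h j i ^ 2) / 2) ≤ Real.exp (R / 2) := by
      gcongr
      exact hR j
    have h4 := h2.trans_le (mul_le_mul_of_nonneg_right h3 (Real.sqrt_nonneg _))
    rw [div_eq_mul_one_div] at h4
    exact lt_of_mul_lt_mul_left h4 (Real.exp_pos _).le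
  have h2 (j : ι) : 1 / (Fintype.card ι : ℝ) < (stdNormal n).real (A j) := by
    have := Real.lt_sqrt (by positivity) |>.1 (h1 j)
    rwa [div_pow, Real.sq_sqrt hm.le, one_pow] at this
  have h3 : ∑ _j : ι, 1 / (Fintype.card ι : ℝ) < ∑ j, (stdNormal n).real (A j) :=
    Finset.sum_lt_sum_of_nonempty Finset.univ_nonempty fun j _ => h2 j
  rw [← measureReal_iUnion_fintype hdisj hA] at h3
  have h4 : (stdNormal n).real (⋃ j, A j) ≤ 1 := measureReal_le_one
  simp only [Finset.sum_const, Finset.card_univ, nsmul_eq_mul, mul_one_div_cancel hm.ne'] at h3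
  linarith

/-- Among sufficiently many separated points of a ball, one is with high probability the starting
point of an increment with a large Gaussian pairing. -/
lemma exists_center_of_separated {𝒳 : Type*} {n : ℕ} (hn : 0 < n) (x : Fin n → 𝒳)
    {ι : Type*} [Fintype ι] (v : ι → 𝒳 → ℝ) (f₀ : 𝒳 → ℝ) {ε R : ℝ} (hε : 0 < ε) (hR : 0 < R)
    (hball : ∀ j, empNorm x (v j - f₀) ≤ 2 * ε)
    (hsep : ∀ j k, j ≠ k → ε < empNorm x (v j - v k))
    (hcard : 64 * Real.exp (R ^ 2) ≤ Fintype.card ι) :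
    ∃ j, (stdNormal n).real
      {g | ∀ k, empPairing x g (v k - v j) < R * ε / (4 * Real.sqrt n)} ≤ 1 / 8 := by
  classical
  have hn' : (0 : ℝ) < n := by exact_mod_cast hn
  have hsn : 0 < Real.sqrt n := Real.sqrt_pos.2 hn'
  have hsn2 : Real.sqrt n ^ 2 = n := Real.sq_sqrt hn'.le
  have hcard0 : (0 : ℝ) < Fintype.card ι := lt_of_lt_of_le (by positivity) hcard
  have : Nonempty ι := Fintype.card_pos_iff.1 (by exact_mod_cast hcard0)
  -- With this scaling the shifts `ρ (v j - f₀)` have squared Euclidean length at most `R²`.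
  set ρ : ℝ := R / (2 * ε * Real.sqrt n) with hρ
  have hρ0 : 0 < ρ := by positivity
  have hρ2 : ρ ^ 2 * n = R ^ 2 / (4 * ε ^ 2) := by
    rw [hρ, div_pow, mul_pow, hsn2]
    field_simp
    norm_num
  let h : ι → Fin n → ℝ := fun j i => ρ * (v j - f₀) (x i)
  have hsum (f : 𝒳 → ℝ) : ∑ i, (f (x i)) ^ 2 = n * empNorm x f ^ 2 := by
    rw [empNorm_sq]
    field_simp
  have hhR (j : ι) : ∑ i, h j i ^ 2 ≤ R ^ 2 := by
    simp only [h, mul_pow, ← Finset.mul_sum]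
    rw [hsum, ← mul_assoc, hρ2]
    have : empNorm x (v j - f₀) ^ 2 ≤ (2 * ε) ^ 2 :=
      pow_le_pow_left₀ (empNorm_nonneg _ _) (hball j) 2
    calc R ^ 2 / (4 * ε ^ 2) * empNorm x (v j - f₀) ^ 2
        ≤ R ^ 2 / (4 * ε ^ 2) * (2 * ε) ^ 2 := by gcongr
      _ = R ^ 2 := by
        field_simp
        norm_num
  -- `ℓ j` is the log-likelihood of the shift `h j`, and `A j` the region where `j` is the strict
  -- maximum-likelihood choice.
  let ℓ : ι → (Fin n → ℝ) → ℝ := fun j y => ∑ i, (y i * h j i - h j i ^ 2 / 2)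
  have hℓ (j : ι) : Continuous (ℓ j) := by fun_prop
  let A : ι → Set (Fin n → ℝ) := fun j => {y | ∀ k, k ≠ j → ℓ k y < ℓ j y}
  have hA (j : ι) : MeasurableSet (A j) := by
    have : A j = ⋂ k, ⋂ (_ : k ≠ j), {y | ℓ k y < ℓ j y} := by
      ext y
      simp [A]
    rw [this]
    exact MeasurableSet.iInter fun k => MeasurableSet.iInter fun _ =>
      (isOpen_lt (hℓ k) (hℓ j)).measurableSet
  have hdisj : Pairwise (Function.onFun Disjoint A) := by
    intro j k hjk
    refine Set.disjoint_left.2 fun y hj hk => ?_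
    exact lt_asymm (hj k hjk.symm) (hk j hjk)
  obtain ⟨j, hj⟩ := exists_stdNormal_shift_le h hhR A hA hdisj
  refine ⟨j, le_trans (measureReal_mono ?_) (hj.trans ?_)⟩
  -- If all pairings from `v j` are small, maximum likelihood recovers `j` from `g + h j`: the noise
  -- term stays below `R²/8`, and separation makes the quadratic term at least `R²/8`.
  · intro g hg k hk
    have h1 : ℓ k (g + h j) - ℓ j (g + h j) =
        ρ * (n * empPairing x g (v k - v j)) - ρ ^ 2 * n * empNorm x (v k - v j) ^ 2 / 2 := by
      rw [mul_assoc, ← hsum]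
      have : (n : ℝ) * empPairing x g (v k - v j) = ∑ i, g i * (v k - v j) (x i) := by
        rw [empPairing]
        field_simp
      rw [this, Finset.mul_sum, Finset.mul_sum, Finset.sum_div, ← Finset.sum_sub_distrib,
        ← Finset.sum_sub_distrib]
      refine Finset.sum_congr rfl fun i _ => ?_
      simp only [h, Pi.add_apply, Pi.sub_apply]
      ring
    have h2 : ρ * (n * empPairing x g (v k - v j)) < R ^ 2 / 8 := by
      calc ρ * (n * empPairing x g (v k - v j))
          < ρ * (n * (R * ε / (4 * Real.sqrt n))) := by
            gcongr
            exact hg k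
        _ = R ^ 2 / 8 := by
            rw [hρ]
            field_simp
            linear_combination -8 * hsn2
    have h3 : R ^ 2 / 8 ≤ ρ ^ 2 * n * empNorm x (v k - v j) ^ 2 / 2 := by
      have h4 : ε ^ 2 ≤ empNorm x (v k - v j) ^ 2 :=
        pow_le_pow_left₀ hε.le (hsep k j hk).le 2
      calc R ^ 2 / 8 = R ^ 2 / (4 * ε ^ 2) * ε ^ 2 / 2 := by
            field_simp
            norm_num
        _ ≤ _ := by
            rw [hρ2]
            gcongr
    show ℓ k (g + h j) < ℓ j (g + h j)
    linarith
  · have h1 : 8 * Real.exp (R ^ 2 / 2) ≤ Real.sqrt (Fintype.card ι) := by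
      refine Real.le_sqrt_of_sq_le ?_
      rw [mul_pow, ← Real.exp_nat_mul]
      convert hcard using 2
      · norm_num
      · congr 1
        push_cast
        ring
    rw [div_le_div_iff₀ (Real.sqrt_pos.2 hcard0) (by norm_num)]
    linarith

/-! ### From entropy bounds to packings and finite nets -/

section Entropy

variable {𝒳 : Type*} {n : ℕ} (x : Fin n → 𝒳)

lemma coe_log_exp (q : ℝ) : (q : EReal) = ENNReal.log (ENNReal.ofReal (Real.exp q)) := by
  rw [ENNReal.log_ofReal_of_pos (Real.exp_pos q), Real.log_exp]

/-- A separated set of maximal cardinality is a net. The maximum exists because the negated claim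
bounds all these cardinalities. -/
lemma exists_separated_of_le_empEntropy {ε q : ℝ} (hε : 0 ≤ ε) {G : Set (𝒳 → ℝ)}
    (h : (q : EReal) ≤ empEntropy x ε G) :
    ∃ S : Finset (𝒳 → ℝ), (∀ v ∈ S, v ∈ G) ∧
      (∀ v ∈ S, ∀ w ∈ S, v ≠ w → ε < empNorm x (v - w)) ∧ Real.exp q ≤ S.card := by
  classical
  by_contra! hcon
  let P : ℕ → Prop := fun m => ∃ S : Finset (𝒳 → ℝ), (∀ v ∈ S, v ∈ G) ∧
      (∀ v ∈ S, ∀ w ∈ S, v ≠ w → ε < empNorm x (v - w)) ∧ S.card = m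
  have hb (m : ℕ) (hm : P m) : m ≤ ⌈Real.exp q⌉₊ := by
    obtain ⟨S, h1, h2, rfl⟩ := hm
    exact_mod_cast (hcon S h1 h2).le.trans (Nat.le_ceil _)
  have hP0 : P 0 := ⟨∅, by simp, by simp, rfl⟩
  obtain ⟨S, h1, h2, h3⟩ : P (Nat.findGreatest P ⌈Real.exp q⌉₊) :=
    Nat.findGreatest_spec (Nat.zero_le _) hP0
  have hcover : ∀ g ∈ G, ∃ g' ∈ (S : Set (𝒳 → ℝ)), empNorm x (g - g') ≤ ε := by
    intro g hg
    by_contra! hfar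
    have hgS : g ∉ S := fun hgS => by
      have := hfar g hgS
      rw [sub_self, empNorm_zero] at this
      linarith
    have hP : P (S.card + 1) := by
      refine ⟨insert g S, ?_, ?_, Finset.card_insert_of_notMem hgS⟩
      · intro v hv
        rcases Finset.mem_insert.1 hv with rfl | hv
        · exact hg
        · exact h1 v hv
      · intro v hv w hw hvw
        rw [Finset.mem_insert] at hv hw
        rcases hv with rfl | hv <;> rcases hw with rfl | hw
        · exact absurd rfl hvw
        · exact hfar w hw
        · rw [empNorm_sub_comm]
          exact hfar v hv
        · exact h2 v hv w hw hvw
    have := Nat.le_findGreatest (hb _ hP) hP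
    omega
  have h4 : empCoveringNumber x ε G ≤ (S.card : ℕ∞) := by
    rw [← Set.encard_coe_eq_coe_finsetCard]
    exact iInf₂_le (S : Set (𝒳 → ℝ)) hcover
  rw [empEntropy, coe_log_exp, ENNReal.log_le_log_iff] at h
  have h5 : ((empCoveringNumber x ε G : ℕ∞) : ℝ≥0∞) ≤ (S.card : ℝ≥0∞) := by
    exact_mod_cast (ENat.toENNReal_le.2 h4)
  have h6 := h.trans h5
  rw [← ENNReal.ofReal_natCast, ENNReal.ofReal_le_ofReal_iff (by positivity)] at h6
  exact absurd (hcon S h1 h2) (not_lt.2 h6)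

lemma exists_net_of_empEntropy_le {ε q : ℝ} {G : Set (𝒳 → ℝ)} (h : empEntropy x ε G ≤ (q : EReal)) :
    ∃ S : Finset (𝒳 → ℝ), (∀ g ∈ G, ∃ s ∈ S, empNorm x (g - s) ≤ ε) ∧ (S.card : ℝ) ≤ Real.exp q := by
  rw [empEntropy, coe_log_exp, ENNReal.log_le_log_iff] at h
  have hne : empCoveringNumber x ε G ≠ ⊤ := by
    intro htop
    rw [htop] at h
    simp at h
  obtain ⟨m, hm⟩ := ENat.ne_top_iff_exists.1 hne
  have h1 : (m : ℝ) ≤ Real.exp q := by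
    rw [← hm, ENat.toENNReal_coe, ← ENNReal.ofReal_natCast,
      ENNReal.ofReal_le_ofReal_iff (by positivity)] at h
    exact h
  -- The strict bound by `m + 1` lets the infimum yield an actual net, of at most `m` elements.
  have h2 : empCoveringNumber x ε G < ((m + 1 : ℕ) : ℕ∞) := by
    rw [← hm]
    exact_mod_cast Nat.lt_succ_self m
  simp only [empCoveringNumber, iInf_lt_iff] at h2
  obtain ⟨N, hN, hlt⟩ := h2
  have hfin : N.Finite := Set.finite_of_encard_le_coe hlt.le
  refine ⟨hfin.toFinset, fun g hg => ?_, le_trans ?_ h1⟩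
  · obtain ⟨s, hs, hgs⟩ := hN g hg
    exact ⟨s, by simpa using hs, hgs⟩
  · rw [hfin.encard_eq_coe_toFinset_card] at hlt
    have : hfin.toFinset.card < m + 1 := by exact_mod_cast hlt
    exact_mod_cast Nat.lt_succ_iff.1 this

end Entropy

/-! ### Chaining with integrable majorants -/

section Chaining

variable {𝒳 : Type*} {n : ℕ} (x : Fin n → 𝒳)

/-- The Gaussian maximal inequality over a finite set of functions. -/
lemma exists_dominating_finset (hn : 0 < n) (P : Finset (𝒳 → ℝ)) {σ q : ℝ} (hσ : 0 < σ) (hq : 0 < q)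
    (hP : ∀ v ∈ P, empNorm x v ≤ σ) (hcard : (P.card : ℝ) ≤ Real.exp q) :
    ∃ Z : (Fin n → ℝ) → ℝ, Integrable Z (stdNormal n) ∧
      (∀ g, ∀ v ∈ P, empPairing x g v ≤ Z g) ∧
      ∫ g, Z g ∂(stdNormal n) ≤ σ * Real.sqrt (2 * q / n) := by
  have hn' : (0 : ℝ) < n := by exact_mod_cast hn
  set w : ℝ := Real.sqrt (2 * q / n) with hw
  have hw0 : 0 < w := Real.sqrt_pos.2 (by positivity)
  have hw2 : w ^ 2 = 2 * q / n := Real.sq_sqrt (by positivity)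
  -- The optimal exponential parameter: `l² σ² / (2n) = q`.
  set l : ℝ := 2 * q / (σ * w) with hl
  have hl0 : 0 < l := by positivity
  have hl2 : l ^ 2 * (σ ^ 2 / n) / 2 = q := by
    rw [hl, div_pow, mul_pow σ, hw2]
    field_simp
  have hint (v : 𝒳 → ℝ) :
      Integrable (fun g => Real.exp (-(2 * q)) * Real.exp (l * empPairing x g v)) (stdNormal n) :=
    (integrable_exp_empPairing x v l).const_mul _
  have hints : Integrable (fun g => ∑ v ∈ P, Real.exp (-(2 * q)) * Real.exp (l * empPairing x g v))
      (stdNormal n) := integrable_finsetSum _ fun v _ => hint v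
  -- The inequality `y + 1 ≤ exp y` at `y = l⟨g, v⟩ - 2q` replaces the logarithm of the sum. The sum
  -- has mean at most `1`, so the mean of the majorant is at most `2q / l = σ w`.
  refine ⟨fun g => (∑ v ∈ P, Real.exp (-(2 * q)) * Real.exp (l * empPairing x g v) + (2 * q - 1)) / l,
    (hints.add (integrable_const _)).div_const _, fun g v hv => ?_, ?_⟩
  · rw [le_div_iff₀ hl0]
    have h1 : Real.exp (-(2 * q)) * Real.exp (l * empPairing x g v) ≤
        ∑ v ∈ P, Real.exp (-(2 * q)) * Real.exp (l * empPairing x g v) :=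
      Finset.single_le_sum (f := fun v => Real.exp (-(2 * q)) * Real.exp (l * empPairing x g v))
        (fun v _ => by positivity) hv
    rw [← Real.exp_add] at h1
    have h2 := Real.add_one_le_exp (-(2 * q) + l * empPairing x g v)
    linarith
  · rw [integral_div, integral_add hints (integrable_const _), integral_finsetSum _ fun v _ => hint v]
    simp only [integral_const_mul, integral_const, probReal_univ, one_smul]
    have h1 (v) (hv : v ∈ P) : Real.exp (-(2 * q)) * ∫ g, Real.exp (l * empPairing x g v) ∂(stdNormal n) ≤
        Real.exp (-q) := by
      have h2 := integral_exp_empPairing_le x v l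
      have h3 : Real.exp (l ^ 2 * (empNorm x v ^ 2 / n) / 2) ≤ Real.exp q := by
        rw [Real.exp_le_exp, ← hl2]
        have := pow_le_pow_left₀ (empNorm_nonneg x v) (hP v hv) 2
        gcongr
      calc _ ≤ Real.exp (-(2 * q)) * Real.exp q := by
            gcongr
            exact h2.trans h3
        _ = Real.exp (-q) := by
            rw [← Real.exp_add]
            congr 1
            ring
    have h4 : ∑ v ∈ P, Real.exp (-(2 * q)) * ∫ g, Real.exp (l * empPairing x g v) ∂(stdNormal n) ≤ 1 := by
      calc _ ≤ ∑ _v ∈ P, Real.exp (-q) := Finset.sum_le_sum h1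
        _ = P.card * Real.exp (-q) := by simp
        _ ≤ Real.exp q * Real.exp (-q) := by gcongr
        _ = 1 := by rw [← Real.exp_add]; simp
    rw [div_le_iff₀ hl0]
    have h5 : σ * w * l = 2 * q := by
      rw [hl]
      field_simp
    linarith

/-- Chaining along dyadic nets that start from a single function. -/
lemma exists_dominating_chain (hn : 0 < n) {G : Set (𝒳 → ℝ)} {f₁ : 𝒳 → ℝ} {t : ℝ} (ht : 0 < t)
    (S : ℕ → Finset (𝒳 → ℝ)) (q : ℕ → ℝ) (hq : ∀ k, 0 < q (k + 1)) (hS0 : S 0 = {f₁}) (K : ℕ)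
    (hcover : ∀ k ≤ K, ∀ f ∈ G, ∃ s ∈ S k, empNorm x (f - s) ≤ t / 2 ^ k)
    (hcard : ∀ k < K, ((S k).card : ℝ) * (S (k + 1)).card ≤ Real.exp (q (k + 1))) :
    ∃ Z : (Fin n → ℝ) → ℝ, Integrable Z (stdNormal n) ∧
      (∀ g, ∀ f ∈ G, ∀ s ∈ S K, empNorm x (f - s) ≤ t / 2 ^ K → empPairing x g (s - f₁) ≤ Z g) ∧
      ∫ g, Z g ∂(stdNormal n) ≤
        ∑ k ∈ Finset.range K, 3 * (t / 2 ^ (k + 1)) * Real.sqrt (2 * q (k + 1) / n) := by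
  classical
  induction K with
  | zero =>
    refine ⟨0, integrable_zero _ _ _, fun g f _ s hs _ => ?_, by simp⟩
    rw [hS0, Finset.mem_singleton] at hs
    simp [hs]
  | succ K ih =>
    obtain ⟨Z, hZi, hZ, hZb⟩ := ih (fun k hk => hcover k (by omega)) (fun k hk => hcard k (by omega))
    -- A link joins net points within `t / 2^K` and `t / 2^(K+1)` of the same `f`, hence the factor
    -- `3 = 2 + 1`.
    let P : Finset (𝒳 → ℝ) := ((S K ×ˢ S (K + 1)).image fun w => w.2 - w.1).filter
      fun v => empNorm x v ≤ 3 * (t / 2 ^ (K + 1))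
    have hPcard : (P.card : ℝ) ≤ Real.exp (q (K + 1)) := by
      refine le_trans ?_ (hcard K (by omega))
      have : P.card ≤ (S K).card * (S (K + 1)).card := by
        rw [← Finset.card_product]
        exact (Finset.card_filter_le _ _).trans Finset.card_image_le
      exact_mod_cast this
    obtain ⟨Y, hYi, hY, hYb⟩ := exists_dominating_finset x hn P (σ := 3 * (t / 2 ^ (K + 1)))
      (by positivity) (hq K) (fun v hv => (Finset.mem_filter.1 hv).2) hPcard
    refine ⟨fun g => Z g + Y g, hZi.add hYi, fun g f hf s hs hfs => ?_, ?_⟩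
    · obtain ⟨s', hs', hfs'⟩ := hcover K (by omega) f hf
      have h1 := hZ g f hf s' hs' hfs'
      have h2 : s - s' ∈ P := by
        refine Finset.mem_filter.2 ⟨Finset.mem_image.2 ⟨(s', s), by simp [hs, hs'], rfl⟩, ?_⟩
        have h3 := empNorm_sub_le x s f s'
        rw [empNorm_sub_comm x s f] at h3
        have h4 : t / 2 ^ K = 2 * (t / 2 ^ (K + 1)) := by
          rw [pow_succ]
          field_simp
        linarith
      have h3 := hY g _ h2
      rw [empPairing_sub] at h1 h3 ⊢
      linarith
    · rw [integral_add hZi hYi, Finset.sum_range_succ]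
      linarith

lemma geom_sum_le {ρ : ℝ} (hρ : 1 < ρ) (K : ℕ) :
    ∑ k ∈ Finset.range K, ρ ^ (k + 1) ≤ ρ / (ρ - 1) * ρ ^ K := by
  have h : 0 < ρ - 1 := by linarith
  simp only [pow_succ, ← Finset.sum_mul]
  rw [geom_sum_eq hρ.ne', div_mul_eq_mul_div, div_mul_eq_mul_div, mul_comm ρ]
  gcongr
  linarith

/-- Dudley's entropy bound, truncated at the level `δ`, for polynomially growing local entropy. -/
lemma exists_dominating_of_empEntropy_le (hn : 0 < n) {F : Set (𝒳 → ℝ)} {f₁ : 𝒳 → ℝ}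
    {p δ t Q : ℝ} (hp : 2 < p) (hδ : 0 < δ) (hδt : δ ≤ t) (hQ : 0 < Q)
    (hent : ∀ ε, δ ≤ ε → ε ≤ t →
      empEntropy x ε (empBall x F f₁ t) ≤ ((Q * (t / ε) ^ p : ℝ) : EReal)) :
    ∃ Z : (Fin n → ℝ) → ℝ, Integrable Z (stdNormal n) ∧
      (∀ g, ∀ f ∈ empBall x F f₁ t, empPairing x g (f - f₁) ≤ Z g) ∧
      ∫ g, Z g ∂(stdNormal n) ≤ 2 * δ +
        6 * (2 ^ (p / 2 - 1) / (2 ^ (p / 2 - 1) - 1)) *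
          (Real.sqrt (Q / n) * t * (t / δ) ^ (p / 2 - 1)) := by
  classical
  have ht : 0 < t := hδ.trans_le hδt
  -- The finest scale `t / 2^K` lies in `[δ, 2δ)`.
  obtain ⟨K, hK1, hK2⟩ := exists_nat_pow_near ((one_le_div hδ).2 hδt) (one_lt_two (α := ℝ))
  have hKδ (k : ℕ) (hk : k ≤ K) : δ ≤ t / 2 ^ k := by
    rw [le_div_iff₀ (by positivity), mul_comm, ← le_div_iff₀ hδ]
    exact (pow_le_pow_right₀ one_le_two hk).trans hK1
  have hnet (k : ℕ) : ∃ S : Finset (𝒳 → ℝ), (k = 0 → S = {f₁}) ∧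
      (k ≤ K → (∀ f ∈ empBall x F f₁ t, ∃ s ∈ S, empNorm x (f - s) ≤ t / 2 ^ k) ∧
        (S.card : ℝ) ≤ Real.exp (Q * (2 ^ k) ^ p)) := by
    rcases Nat.eq_zero_or_pos k with rfl | hk0
    · refine ⟨{f₁}, fun _ => rfl, fun _ => ⟨fun f hf => ⟨f₁, by simp, by simpa using hf.2⟩, ?_⟩⟩
      simpa using hQ.le
    · by_cases hk : k ≤ K
      · have h1 := hent (t / 2 ^ k) (hKδ k hk) (div_le_self ht.le (one_le_pow₀ one_le_two))
        rw [div_div_cancel₀ ht.ne'] at h1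
        obtain ⟨S, hS1, hS2⟩ := exists_net_of_empEntropy_le x h1
        exact ⟨S, fun h => by omega, fun _ => ⟨hS1, hS2⟩⟩
      · exact ⟨∅, fun h => by omega, fun h => absurd h hk⟩
  choose S hS0 hS using hnet
  obtain ⟨Z, hZi, hZ, hZb⟩ := exists_dominating_chain x hn ht S (fun k => 2 * (Q * (2 ^ k) ^ p))
    (fun k => by positivity) (hS0 0 rfl) K (fun k hk => (hS k hk).1) (fun k hk => by
      have h1 := (hS k hk.le).2
      have h2 := (hS (k + 1) hk).2
      have h3 : Real.exp (Q * (2 ^ k) ^ p) ≤ Real.exp (Q * (2 ^ (k + 1)) ^ p) := by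
        gcongr
        · exact one_le_two
        · omega
      calc _ ≤ Real.exp (Q * (2 ^ (k + 1)) ^ p) * Real.exp (Q * (2 ^ (k + 1)) ^ p) := by
            gcongr
            exact h1.trans h3
        _ = _ := by
            rw [← Real.exp_add]
            congr 1
            ring)
  -- The part below the finest scale is bounded by Cauchy–Schwarz and `y ≤ (1 + y²)/2`.
  have hYi : Integrable (fun g : Fin n → ℝ => t / 2 ^ K * ((1 + empNorm id g ^ 2) / 2))
      (stdNormal n) :=
    (((integrable_const 1).add integrable_empNorm_id_sq).div_const 2).const_mul _
  refine ⟨fun g => t / 2 ^ K * ((1 + empNorm id g ^ 2) / 2) + Z g, hYi.add hZi,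
    fun g f hf => ?_, ?_⟩
  · obtain ⟨s, hs, hfs⟩ := (hS K le_rfl).1 f hf
    have h1 := hZ g f hf s hs hfs
    have h2 := empPairing_le x g (f - s)
    have h3 : empNorm id g * empNorm x (f - s) ≤ (1 + empNorm id g ^ 2) / 2 * (t / 2 ^ K) := by
      gcongr
      · exact empNorm_nonneg _ _
      · nlinarith [sq_nonneg (empNorm id g - 1)]
    rw [empPairing_sub] at h1 h2 ⊢
    linarith
  · rw [integral_add hYi hZi]
    have h1 : ∫ g : Fin n → ℝ, t / 2 ^ K * ((1 + empNorm id g ^ 2) / 2) ∂(stdNormal n) ≤ 2 * δ := by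
      rw [integral_const_mul, integral_div,
        integral_add (integrable_const 1) integrable_empNorm_id_sq]
      have h2 : t / 2 ^ K ≤ 2 * δ := by
        rw [div_le_iff₀ (by positivity)]
        rw [div_lt_iff₀ hδ, pow_succ] at hK2
        linarith
      have h3 := integral_empNorm_id_sq_le (n := n)
      simp only [integral_const, probReal_univ, one_smul]
      calc _ ≤ t / 2 ^ K * 1 := by
            gcongr
            linarith
        _ ≤ _ := by linarith
    -- Since `p > 2`, the series has ratio `2^(p/2 - 1) > 1` and its last term dominates.
    have h4 : ∑ k ∈ Finset.range K,
        3 * (t / 2 ^ (k + 1)) * Real.sqrt (2 * (2 * (Q * (2 ^ (k + 1)) ^ p)) / n) =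
        6 * t * Real.sqrt (Q / n) * ∑ k ∈ Finset.range K, ((2 : ℝ) ^ (p / 2 - 1)) ^ (k + 1) := by
      rw [Finset.mul_sum]
      refine Finset.sum_congr rfl fun k _ => ?_
      have h5 : (2 : ℝ) * (2 * (Q * (2 ^ (k + 1)) ^ p)) / n =
          (2 * ((2 : ℝ) ^ (k + 1)) ^ (p / 2)) ^ 2 * (Q / n) := by
        rw [mul_pow, ← Real.rpow_mul_natCast (by positivity)]
        push_cast
        rw [div_mul_cancel₀ _ two_ne_zero]
        ring
      rw [h5, Real.sqrt_mul (by positivity), Real.sqrt_sq (by positivity),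
        Real.rpow_pow_comm (by norm_num), Real.rpow_sub_one (by positivity)]
      ring
    have h6 : ((2 : ℝ) ^ (p / 2 - 1)) ^ K ≤ (t / δ) ^ (p / 2 - 1) := by
      rw [Real.rpow_pow_comm (by norm_num)]
      gcongr
      linarith
    have hρ : (1 : ℝ) < 2 ^ (p / 2 - 1) := Real.one_lt_rpow one_lt_two (by linarith)
    have hρ' : (0 : ℝ) < 2 ^ (p / 2 - 1) - 1 := by linarith
    have h7 := geom_sum_le hρ K
    refine add_le_add h1 (hZb.trans ?_)
    rw [h4]
    calc _ ≤ 6 * t * Real.sqrt (Q / n) *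
          (2 ^ (p / 2 - 1) / (2 ^ (p / 2 - 1) - 1) * (t / δ) ^ (p / 2 - 1)) := by
          gcongr
          exact h7.trans (by gcongr)
      _ = _ := by ring

end Chaining

/-! ### From the noise pairing to the risk of least squares -/

section Risk

variable {𝒳 : Type*} {n : ℕ} (x : Fin n → 𝒳)

/-- A large local packing around `f₀` forces, with high probability, a large Gaussian pairing in a
neighbourhood of a nearby function `f₁`. -/
lemma exists_event_large_pairing (hn : 0 < n) {F : Set (𝒳 → ℝ)} {f₀ f₁ : 𝒳 → ℝ} {ε R q D : ℝ}
    (hε : 0 < ε) (hR : 0 < R)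
    (hq : (q : EReal) ≤ empEntropy x ε (empBall x F f₀ (2 * ε)))
    (hRq : 64 * Real.exp (R ^ 2) ≤ Real.exp q)
    (hfD : 2 * ε + empNorm x (f₁ - f₀) ≤ D)
    (htail : Real.exp (-(R * ε / (8 * Real.sqrt n)) ^ 2 / (2 * (D ^ 2 / n))) ≤ 1 / 8) :
    ∃ A : Set (Fin n → ℝ), MeasurableSet A ∧ 3 / 4 ≤ (stdNormal n).real A ∧
      ∀ g ∈ A, ∃ f ∈ F, empNorm x (f - f₁) ≤ D ∧
        R * ε / (8 * Real.sqrt n) ≤ empPairing x g (f - f₁) := by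
  have hn' : (0 : ℝ) < n := by exact_mod_cast hn
  obtain ⟨S, hS1, hS2, hS3⟩ := exists_separated_of_le_empEntropy x hε.le hq
  obtain ⟨j, hj⟩ := exists_center_of_separated hn x (ι := S) (fun v => v.1) f₀ hε hR
    (fun v => (hS1 v v.2).2) (fun v w hvw => hS2 v v.2 w w.2 (fun h => hvw (Subtype.ext h)))
    (by simpa using hRq.trans hS3)
  have hdist (v : 𝒳 → ℝ) (hv : v ∈ S) : empNorm x (v - f₁) ≤ D := by
    have h1 := empNorm_sub_le x v f₀ f₁
    rw [empNorm_sub_comm x f₀] at h1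
    have h2 := (hS1 v hv).2
    linarith
  set η : ℝ := R * ε / (8 * Real.sqrt n) with hη
  have hη0 : 0 < η := by positivity
  have hη2 : R * ε / (4 * Real.sqrt n) = 2 * η := by
    rw [hη]
    field_simp
    norm_num
  rw [hη2] at hj
  -- Off `E₁` some increment from `v j` has pairing at least `2η`; off `E₂`, moving the starting
  -- point from `v j` to `f₁` costs less than `η`.
  let E₁ : Set (Fin n → ℝ) := {g | ∀ k : S, empPairing x g (k.1 - j.1) < 2 * η}
  let E₂ : Set (Fin n → ℝ) := {g | η ≤ empPairing x g (f₁ - j.1)}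
  have hE₁ : MeasurableSet E₁ := by
    have : E₁ = ⋂ k : S, {g | empPairing x g (k.1 - j.1) < 2 * η} := by
      ext g
      simp [E₁]
    rw [this]
    exact MeasurableSet.iInter fun k =>
      (isOpen_lt (continuous_empPairing x _) continuous_const).measurableSet
  have hE₂ : MeasurableSet E₂ :=
    (isClosed_le continuous_const (continuous_empPairing x _)).measurableSet
  have hE₂' : (stdNormal n).real E₂ ≤ 1 / 8 := by
    -- At norm zero, division by zero turns the tail bound into `exp 0 = 1`, so this case is
    -- separate.
    rcases (empNorm_nonneg x (f₁ - j.1)).eq_or_lt with h0 | h0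
    · have hE : E₂ = ∅ := by
        refine Set.eq_empty_of_forall_notMem fun g hg => ?_
        have h1 := empPairing_le x g (f₁ - j.1)
        rw [← h0, mul_zero] at h1
        have h2 : η ≤ empPairing x g (f₁ - j.1) := hg
        linarith
      rw [hE]
      simp
    · refine (measureReal_empPairing_ge_le x _ hη0.le).trans (le_trans ?_ htail)
      have h1 : empNorm x (f₁ - j.1) ≤ D := by
        rw [empNorm_sub_comm]
        exact hdist j j.2
      rw [Real.exp_le_exp, neg_div, neg_div, neg_le_neg_iff]
      gcongr
  refine ⟨E₁ᶜ ∩ E₂ᶜ, hE₁.compl.inter hE₂.compl, ?_, fun g hg => ?_⟩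
  · rw [← Set.compl_union, probReal_compl_eq_one_sub (hE₁.union hE₂)]
    have := measureReal_union_le (μ := stdNormal n) E₁ E₂
    have hj' : (stdNormal n).real E₁ ≤ 1 / 8 := hj
    linarith
  · obtain ⟨h1, h2⟩ := hg
    have h3 : ∃ k : S, 2 * η ≤ empPairing x g (k.1 - j.1) := by
      by_contra! hcon
      exact h1 hcon
    obtain ⟨k, hk⟩ := h3
    have h4 : empPairing x g (f₁ - j.1) < η := not_le.1 h2
    refine ⟨k.1, (hS1 k k.2).1, hdist k k.2, ?_⟩
    rw [empPairing_sub] at *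
    linarith

/-- Expanding the residual sum at truth `f₁` shows that the objective is `(∑ g² - residual sum) /
(2n)`. -/
lemma IsLeastSquaresEstimator.objective_le {F : Set (𝒳 → ℝ)} {fhat : (Fin n → ℝ) → (𝒳 → ℝ)}
    (hfhat : IsLeastSquaresEstimator x F fhat) (f₁ : 𝒳 → ℝ) {f : 𝒳 → ℝ} (hf : f ∈ F)
    (g : Fin n → ℝ) :
    empPairing x g (f - f₁) - empNorm x (f - f₁) ^ 2 / 2 ≤
      empPairing x g (fhat (fun i => f₁ (x i) + g i) - f₁) -
        empNorm x (fhat (fun i => f₁ (x i) + g i) - f₁) ^ 2 / 2 := by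
  have key (u : 𝒳 → ℝ) : empPairing x g (u - f₁) - empNorm x (u - f₁) ^ 2 / 2 =
      (1 / (n : ℝ)) / 2 * (∑ i, g i ^ 2 - ∑ i, (f₁ (x i) + g i - u (x i)) ^ 2) := by
    have h : ∑ i, g i ^ 2 - ∑ i, (f₁ (x i) + g i - u (x i)) ^ 2 =
        2 * ∑ i, g i * (u - f₁) (x i) - ∑ i, (u - f₁) (x i) ^ 2 := by
      rw [Finset.mul_sum, ← Finset.sum_sub_distrib, ← Finset.sum_sub_distrib]
      refine Finset.sum_congr rfl fun i _ => ?_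
      simp only [Pi.sub_apply]
      ring
    rw [h, empNorm_sq, empPairing]
    ring
  rw [key, key]
  have := (hfhat fun i => f₁ (x i) + g i).2 f hf
  gcongr

/-- If with high probability the noise correlates strongly with the class at distance `D` from
`f₁`, but on average only weakly within distance `t`, then the least squares estimator has risk of
order `t ^ 2` at `f₁`. -/
lemma le_worstCaseRisk {F : Set (𝒳 → ℝ)} (hF : Convex ℝ F)
    {fhat : (Fin n → ℝ) → (𝒳 → ℝ)} (hfhat : IsLeastSquaresEstimator x F fhat)
    {f₁ : 𝒳 → ℝ} (hf₁ : f₁ ∈ F) {D η l κ t : ℝ} (ht : 0 < t) (hl0 : 0 ≤ l) (hl1 : l ≤ 1)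
    (hκ : 0 < κ) (hκl : κ ≤ l * η - (l * D) ^ 2 / 2)
    {A : Set (Fin n → ℝ)} (hA : MeasurableSet A) (hAp : 3 / 4 ≤ (stdNormal n).real A)
    (hAf : ∀ g ∈ A, ∃ f ∈ F, empNorm x (f - f₁) ≤ D ∧ η ≤ empPairing x g (f - f₁))
    {Z : (Fin n → ℝ) → ℝ} (hZi : Integrable Z (stdNormal n))
    (hZ : ∀ g, ∀ f ∈ empBall x F f₁ t, empPairing x g (f - f₁) ≤ Z g)
    (hZb : ∫ g, Z g ∂(stdNormal n) ≤ κ / 4) :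
    ENNReal.ofReal (t ^ 2 / 2) ≤ worstCaseRisk x F fhat := by
  have hZ0 (g : Fin n → ℝ) : 0 ≤ Z g := by
    simpa using hZ g f₁ ⟨hf₁, by simpa using ht.le⟩
  have hobj (g : Fin n → ℝ) (hg : g ∈ A) :
      κ ≤ empPairing x g (fhat (fun i => f₁ (x i) + g i) - f₁) := by
    obtain ⟨f, hf, hfD, hfη⟩ := hAf g hg
    -- Contraction by `l` scales the pairing by `l` but the penalty by `l²`.
    have hmem : f₁ + l • (f - f₁) ∈ F := hF.add_smul_sub_mem hf₁ hf ⟨hl0, hl1⟩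
    have h1 := hfhat.objective_le x f₁ hmem g
    rw [add_sub_cancel_left, empPairing_smul, empNorm_smul, abs_of_nonneg hl0] at h1
    have h2 : (l * empNorm x (f - f₁)) ^ 2 ≤ (l * D) ^ 2 :=
      pow_le_pow_left₀ (mul_nonneg hl0 (empNorm_nonneg _ _)) (by gcongr) 2
    have h3 : l * η ≤ l * empPairing x g (f - f₁) := by gcongr
    have h4 := sq_nonneg (empNorm x (fhat (fun i => f₁ (x i) + g i) - f₁))
    linarith
  have hmarkov : (stdNormal n).real {g | κ ≤ Z g} ≤ 1 / 4 := by
    have := mul_meas_ge_le_integral_of_nonneg (ae_of_all _ hZ0) hZi κ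
    have h1 : κ * (stdNormal n).real {g | κ ≤ Z g} ≤ κ * (1 / 4) := by linarith
    exact le_of_mul_le_mul_left h1 hκ
  have hB : NullMeasurableSet {g | κ ≤ Z g} (stdNormal n) :=
    nullMeasurableSet_le aemeasurable_const hZi.aemeasurable
  have hprob : 1 / 2 ≤ (stdNormal n).real (A \ {g | κ ≤ Z g}) := by
    have h1 := measureReal_mono (μ := stdNormal n)
      (s₁ := A) (s₂ := (A \ {g | κ ≤ Z g}) ∪ {g | κ ≤ Z g}) (by simp)
    have h2 := measureReal_union_le (μ := stdNormal n) (A \ {g | κ ≤ Z g}) {g | κ ≤ Z g}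
    linarith
  refine le_trans ?_ (le_iSup₂ (f := fun f (_ : f ∈ F) => ∫⁻ ξ, ENNReal.ofReal
    ((empNorm x (fhat (fun i => f (x i) + ξ i) - f)) ^ 2) ∂(stdNormal n)) f₁ hf₁)
  calc ENNReal.ofReal (t ^ 2 / 2)
      = ENNReal.ofReal (t ^ 2) * ENNReal.ofReal (1 / 2) := by
        rw [← ENNReal.ofReal_mul (sq_nonneg t)]
        congr 1
        ring
    _ ≤ ENNReal.ofReal (t ^ 2) * stdNormal n (A \ {g | κ ≤ Z g}) := by
        gcongr
        rwa [ENNReal.ofReal_le_iff_le_toReal (by finiteness)]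
    _ = ∫⁻ ξ, (A \ {g | κ ≤ Z g}).indicator (fun _ => ENNReal.ofReal (t ^ 2)) ξ ∂(stdNormal n) :=
        (lintegral_indicator_const₀ (hA.nullMeasurableSet.diff hB) _).symm
    _ ≤ _ := by
        refine lintegral_mono fun g => ?_
        refine Set.indicator_apply_le' (fun hg => ?_) (fun _ => zero_le)
        refine ENNReal.ofReal_le_ofReal (pow_le_pow_left₀ ht.le ?_ 2)
        -- Inside the ball the estimator's pairing is at most `Z g < κ`, against `hobj`.
        by_contra! hcon
        exact hg.2 ((hobj g hg.1).trans (hZ g _ ⟨(hfhat _).1, hcon.le⟩))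

lemma bddAbove_empPairing_image {G : Set (𝒳 → ℝ)} {C : ℝ} (hC : ∀ f ∈ G, empNorm x f ≤ C)
    (g : Fin n → ℝ) : BddAbove ((fun f : 𝒳 → ℝ => empPairing x g f) '' G) := by
  refine ⟨empNorm id g * C, ?_⟩
  rintro _ ⟨f, hf, rfl⟩
  exact (empPairing_le x g f).trans
    (mul_le_mul_of_nonneg_left (hC f hf) (empNorm_nonneg _ _))

lemma continuous_empNorm_id : Continuous fun g : Fin n → ℝ => empNorm id g := by
  unfold empNorm
  fun_prop

lemma sSup_empPairing_le_add {G : Set (𝒳 → ℝ)} (hG : G.Nonempty) {C : ℝ}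
    (hC : ∀ f ∈ G, empNorm x f ≤ C) (g h : Fin n → ℝ) :
    sSup ((fun f : 𝒳 → ℝ => empPairing x g f) '' G) ≤
      sSup ((fun f : 𝒳 → ℝ => empPairing x h f) '' G) + empNorm id (g - h) * C := by
  refine csSup_le (hG.image _) ?_
  rintro _ ⟨f, hf, rfl⟩
  have h1 : empPairing x h f ≤ sSup ((fun f : 𝒳 → ℝ => empPairing x h f) '' G) :=
    le_csSup (bddAbove_empPairing_image x hC h) ⟨f, hf, rfl⟩
  have h2 := empPairing_le x (g - h) f
  have h3 : empPairing x (g - h) f = empPairing x g f - empPairing x h f := by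
    simp [empPairing, sub_mul, mul_sub, Finset.sum_sub_distrib]
  have h4 := mul_le_mul_of_nonneg_left (hC f hf) (empNorm_nonneg id (g - h))
  simp only
  linarith

/-- The supremum is Lipschitz in the noise, hence continuous, and vanishes at `g = 0`, hence has
linear growth. -/
lemma integrable_sSup_empPairing {G : Set (𝒳 → ℝ)} (hG : G.Nonempty) {C : ℝ} (hC0 : 0 ≤ C)
    (hC : ∀ f ∈ G, empNorm x f ≤ C) :
    Integrable (fun g => sSup ((fun f : 𝒳 → ℝ => empPairing x g f) '' G)) (stdNormal n) := by
  have hlip (g h : Fin n → ℝ) :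
      |sSup ((fun f : 𝒳 → ℝ => empPairing x g f) '' G) -
        sSup ((fun f : 𝒳 → ℝ => empPairing x h f) '' G)| ≤ empNorm id (g - h) * C := by
    have h1 := sSup_empPairing_le_add x hG hC g h
    have h2 := sSup_empPairing_le_add x hG hC h g
    rw [empNorm_sub_comm] at h2
    rw [abs_le]
    constructor <;> linarith
  have hcont : Continuous fun g => sSup ((fun f : 𝒳 → ℝ => empPairing x g f) '' G) := by
    refine continuous_iff_continuousAt.2 fun h => ?_
    rw [ContinuousAt, tendsto_iff_norm_sub_tendsto_zero]
    refine squeeze_zero (fun g => norm_nonneg _) (fun g => hlip g h) ?_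
    have h1 : Continuous fun g : Fin n → ℝ => empNorm id (g - h) * C :=
      (continuous_empNorm_id.comp (continuous_id.sub continuous_const)).mul continuous_const
    simpa using h1.tendsto h
  have hbound : Integrable (fun g : Fin n → ℝ => (1 + empNorm id g ^ 2) / 2 * C) (stdNormal n) :=
    (((integrable_const 1).add integrable_empNorm_id_sq).div_const 2).mul_const _
  refine hbound.mono' hcont.aestronglyMeasurable (ae_of_all _ fun g => ?_)
  have h1 := hlip g 0
  have h2 : (fun f : 𝒳 → ℝ => empPairing x 0 f) '' G = {0} := by
    have : (fun f : 𝒳 → ℝ => empPairing x (0 : Fin n → ℝ) f) = fun _ => 0 := by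
      ext f
      simp [empPairing]
    rw [this]
    exact hG.image_const 0
  rw [h2, csSup_singleton, sub_zero, sub_zero] at h1
  rw [Real.norm_eq_abs]
  refine h1.trans ?_
  gcongr
  nlinarith [sq_nonneg (empNorm id g - 1)]

/-- A bound on the Gaussian width of one ball of a convex class controls all larger balls. -/
lemma exists_dominating_of_gaussianWidth_le {F : Set (𝒳 → ℝ)} (hF : Convex ℝ F) {f₁ : 𝒳 → ℝ}
    (hf₁ : f₁ ∈ F) {t u W : ℝ} (ht : 0 < t) (htu : t ≤ u)
    (hW : gaussianWidth x (empBall x F f₁ t) ≤ W * t) :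
    ∃ Z : (Fin n → ℝ) → ℝ, Integrable Z (stdNormal n) ∧
      (∀ g, ∀ f ∈ empBall x F f₁ u, empPairing x g (f - f₁) ≤ Z g) ∧
      ∫ g, Z g ∂(stdNormal n) ≤ W * u := by
  have hu : 0 < u := ht.trans_le htu
  have hmem : f₁ ∈ empBall x F f₁ t := ⟨hf₁, by simpa using ht.le⟩
  have hC (f : 𝒳 → ℝ) (hf : f ∈ empBall x F f₁ t) : empNorm x f ≤ t + empNorm x f₁ := by
    have := empNorm_add_le x (f - f₁) f₁
    rw [sub_add_cancel] at this
    linarith [hf.2]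
  have hMi := integrable_sSup_empPairing x ⟨f₁, hmem⟩
    (add_nonneg ht.le (empNorm_nonneg x f₁)) hC
  -- The width is not centred at `f₁`; subtracting the mean-zero pairing with `f₁` centres it for
  -- free.
  refine ⟨fun g => u / t * (sSup ((fun f : 𝒳 → ℝ => empPairing x g f) '' empBall x F f₁ t) -
    empPairing x g f₁), (hMi.sub (integrable_empPairing x f₁)).const_mul _, fun g f hf => ?_, ?_⟩
  · have h1 : f₁ + (t / u) • (f - f₁) ∈ empBall x F f₁ t := by
      refine ⟨hF.add_smul_sub_mem hf₁ hf.1 ⟨by positivity, (div_le_one hu).2 htu⟩, ?_⟩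
      rw [add_sub_cancel_left, empNorm_smul, abs_of_pos (by positivity), div_mul_eq_mul_div,
        div_le_iff₀ hu]
      exact mul_le_mul_of_nonneg_left hf.2 ht.le
    have h2 : empPairing x g (f₁ + (t / u) • (f - f₁)) ≤
        sSup ((fun f : 𝒳 → ℝ => empPairing x g f) '' empBall x F f₁ t) :=
      le_csSup (bddAbove_empPairing_image x hC g) ⟨_, h1, rfl⟩
    rw [empPairing_add, empPairing_smul] at h2
    calc empPairing x g (f - f₁) = u / t * (t / u * empPairing x g (f - f₁)) := by
          field_simp
      _ ≤ _ := mul_le_mul_of_nonneg_left (by linarith) (by positivity)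
  · rw [integral_const_mul, integral_sub hMi (integrable_empPairing x f₁), integral_empPairing,
      sub_zero]
    calc u / t * gaussianWidth x (empBall x F f₁ t) ≤ u / t * (W * t) :=
        mul_le_mul_of_nonneg_left hW (by positivity)
      _ = W * u := by field_simp

end Risk

/-! ### Calculus of the rates `n^u (log n)^v` -/

section Rate

open Filter Topology

lemma rate_pos {n : ℕ} (hn : 3 ≤ n) (u v : ℝ) : 0 < rate n u v := by
  have h1 : (1 : ℝ) < n := by exact_mod_cast (by omega : 1 < n)
  have h2 := Real.log_pos h1
  unfold rate
  positivity

lemma rate_mul {n : ℕ} (hn : 3 ≤ n) (u v u' v' : ℝ) :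
    rate n u v * rate n u' v' = rate n (u + u') (v + v') := by
  have h1 : (1 : ℝ) < n := by exact_mod_cast (by omega : 1 < n)
  have h2 := Real.log_pos h1
  unfold rate
  rw [Real.rpow_add (by positivity), Real.rpow_add h2]
  ring

lemma rate_rpow {n : ℕ} (hn : 3 ≤ n) (u v w : ℝ) : rate n u v ^ w = rate n (u * w) (v * w) := by
  have h1 : (1 : ℝ) < n := by exact_mod_cast (by omega : 1 < n)
  have h2 := Real.log_pos h1
  unfold rate
  rw [Real.mul_rpow (by positivity) (by positivity), ← Real.rpow_mul (by positivity),
    ← Real.rpow_mul h2.le]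

lemma rate_inv {n : ℕ} (hn : 3 ≤ n) (u v : ℝ) : (rate n u v)⁻¹ = rate n (-u) (-v) := by
  rw [← Real.rpow_neg_one, rate_rpow hn]
  simp

lemma tendsto_rate_zero {u : ℝ} (hu : u < 0) (v : ℝ) :
    Tendsto (fun n : ℕ => rate n u v) atTop (𝓝 0) := by
  have h := (isLittleO_log_rpow_rpow_atTop v (neg_pos.2 hu)).tendsto_div_nhds_zero.comp
    tendsto_natCast_atTop_atTop
  refine h.congr fun n => ?_
  simp only [Function.comp, rate]
  rw [Real.rpow_neg (Nat.cast_nonneg n), div_inv_eq_mul, mul_comm]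

lemma eventually_rate_le {u : ℝ} (hu : u < 0) (v : ℝ) {C : ℝ} (hC : 0 < C) :
    ∀ᶠ n : ℕ in atTop, rate n u v ≤ C :=
  (tendsto_rate_zero hu v).eventually_le_const hC

lemma eventually_le_rate {u : ℝ} (hu : 0 < u) (v C : ℝ) :
    ∀ᶠ n : ℕ in atTop, C ≤ rate n u v := by
  have hC : 0 < max C 1 := lt_max_of_lt_right one_pos
  filter_upwards [eventually_rate_le (neg_lt_zero.2 hu) (-v) (inv_pos.2 hC), eventually_ge_atTop 3]
    with n hn hn3
  rw [← rate_inv hn3, inv_le_inv₀ (rate_pos hn3 _ _) hC] at hn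
  exact (le_max_left _ _).trans hn

lemma rate_mul_natCast {n : ℕ} (hn : 3 ≤ n) (u v : ℝ) : rate n u v * n = rate n (u + 1) v := by
  have h : (n : ℝ) = rate n 1 0 := by simp [rate]
  calc rate n u v * n = rate n u v * rate n 1 0 := by rw [← h]
    _ = rate n (u + 1) v := by rw [rate_mul hn, add_zero]

end Rate

/-! ### Insertion of the rates and choice of constants -/

section Main

open Filter

variable {𝒳 : Type*} {n : ℕ} (x : Fin n → 𝒳)

/-- The exponent `s` is fixed by `ε^(1 - p/2) / √n` being of order `n^(-1/p) (log n)^(-2s)`, which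
is also the order of the squared distance to `f₀`. -/
lemma exists_event_large_pairing_rate (hn : 3 ≤ n) {F : Set (𝒳 → ℝ)} {f₀ f₁ : 𝒳 → ℝ}
    {p γ c₁ C₁ C₂ ε₀ : ℝ} (hp : 2 < p) (hc₁ : 0 < c₁) (hC₁ : 0 < C₁) (hC₂ : 0 < C₂)
    (hε₀ : rate n (-1 / p) γ ≤ ε₀ / C₁)
    (hεb : rate n (-1 / (2 * p)) (γ + sExp p γ) ≤ 1 / C₁)
    (hlarge : 64 / (c₁ / 2 * C₁ ^ (-p)) ≤ rate n 1 (-(γ * p)))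
    (htail : 7 * (2 * (C₂ + 2) ^ 2) / (Real.sqrt (c₁ / 2) / 8 * C₁ ^ (1 - p / 2)) ^ 2 ≤
      rate n (1 - 1 / p) (-2 * sExp p γ))
    (hent : ∀ ε : ℝ, C₁ * rate n (-1 / p) γ ≤ ε → ε ≤ ε₀ →
      ((c₁ * ε ^ (-p) : ℝ) : EReal) ≤ empEntropy x ε (empBall x F f₀ (2 * ε)))
    (hdist : empNorm x (f₁ - f₀) ≤ C₂ * rate n (-1 / (2 * p)) (-sExp p γ)) :
    ∃ A : Set (Fin n → ℝ), MeasurableSet A ∧ 3 / 4 ≤ (stdNormal n).real A ∧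
      ∀ g ∈ A, ∃ f ∈ F, empNorm x (f - f₁) ≤ (C₂ + 2) * rate n (-1 / (2 * p)) (-sExp p γ) ∧
        Real.sqrt (c₁ / 2) / 8 * C₁ ^ (1 - p / 2) * rate n (-1 / p) (-2 * sExp p γ) ≤
          empPairing x g (f - f₁) := by
  have hp0 : p ≠ 0 := by linarith
  set κ₀ : ℝ := Real.sqrt (c₁ / 2) / 8 * C₁ ^ (1 - p / 2) with hκ₀
  have hκ₀0 : 0 < κ₀ := by
    have := Real.sqrt_pos.2 (half_pos hc₁)
    positivity
  set b : ℝ := rate n (-1 / (2 * p)) (-sExp p γ) with hb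
  have hb0 : 0 < b := rate_pos hn _ _
  set ε : ℝ := C₁ * rate n (-1 / p) γ with hε
  have hr0 : 0 < rate n (-1 / p) γ := rate_pos hn _ _
  have hε0 : 0 < ε := by positivity
  have hεle : ε ≤ ε₀ := by
    rw [le_div_iff₀ hC₁] at hε₀
    linarith
  have hεb' : ε ≤ b := by
    have h1 : rate n (-1 / p) γ = b * rate n (-1 / (2 * p)) (γ + sExp p γ) := by
      rw [hb, rate_mul hn]
      congr 1
      · field_simp
        norm_num
      · ring
    rw [hε, h1]
    calc C₁ * (b * rate n (-1 / (2 * p)) (γ + sExp p γ)) ≤ C₁ * (b * (1 / C₁)) := by gcongr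
      _ = b := by field_simp
  -- `R²` is half of the entropy bound; the other half absorbs the factor `64`.
  set R : ℝ := Real.sqrt (c₁ / 2) * ε ^ (-p / 2) with hR
  have hR0 : 0 < R := by
    have := Real.sqrt_pos.2 (half_pos hc₁)
    positivity
  have hR2 : R ^ 2 = c₁ / 2 * ε ^ (-p) := by
    rw [hR, mul_pow, Real.sq_sqrt (by positivity), ← Real.rpow_mul_natCast hε0.le]
    push_cast
    rw [div_mul_cancel₀ _ two_ne_zero]
  have hR64 : 64 ≤ R ^ 2 := by
    have h1 : ε ^ (-p) = C₁ ^ (-p) * rate n 1 (-(γ * p)) := by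
      rw [hε, Real.mul_rpow hC₁.le hr0.le, rate_rpow hn]
      congr 2
      · field_simp
      · ring
    rw [div_le_iff₀ (by positivity)] at hlarge
    rw [hR2, h1]
    linarith
  have hη : R * ε / (8 * Real.sqrt n) = κ₀ * rate n (-1 / p) (-2 * sExp p γ) := by
    have h1 : ε ^ (-p / 2) * ε = ε ^ (1 - p / 2) := by
      rw [← Real.rpow_add_one hε0.ne']
      congr 1
      ring
    have h2 : (Real.sqrt n)⁻¹ = rate n (-1 / 2) 0 := by
      rw [rate, Real.rpow_zero, mul_one, Real.sqrt_eq_rpow, neg_div,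
        Real.rpow_neg (Nat.cast_nonneg n)]
    have h3 : rate n (-1 / p) (-2 * sExp p γ) =
        rate n (-1 / p) γ ^ (1 - p / 2) * rate n (-1 / 2) 0 := by
      rw [rate_rpow hn, rate_mul hn]
      congr 1
      · field_simp
        ring
      · rw [sExp]
        ring
    rw [h3, ← h2, hκ₀, hR]
    calc Real.sqrt (c₁ / 2) * ε ^ (-p / 2) * ε / (8 * Real.sqrt n)
        = Real.sqrt (c₁ / 2) / 8 * (ε ^ (-p / 2) * ε) * (Real.sqrt n)⁻¹ := by
          field_simp
      _ = _ := by
          rw [h1, hε, Real.mul_rpow hC₁.le hr0.le]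
          ring
  have hbsq : b ^ 2 = rate n (-1 / p) (-2 * sExp p γ) := by
    rw [hb, sq, rate_mul hn]
    congr 1
    · field_simp
      norm_num
    · ring
  rw [← hη]
  refine exists_event_large_pairing x (by omega) hε0 hR0 (hent ε le_rfl hεle) ?_ (by linarith) ?_
  · have h1 : c₁ * ε ^ (-p) = R ^ 2 + R ^ 2 := by
      rw [hR2]
      ring
    rw [h1, Real.exp_add]
    gcongr
    linarith [Real.add_one_le_exp (R ^ 2)]
  · rw [hη, ← hbsq]
    set z : ℝ := (κ₀ * b ^ 2) ^ 2 / (2 * (((C₂ + 2) * b) ^ 2 / n)) with hz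
    have hn0 : (0 : ℝ) < n := by exact_mod_cast (by omega : 0 < n)
    -- Then `exp z ≥ z + 1 ≥ 8`, which gives the tail `1/8`.
    have hz7 : 7 ≤ z := by
      have h1 : rate n (1 - 1 / p) (-2 * sExp p γ) = n * b ^ 2 := by
        rw [hbsq, mul_comm (n : ℝ), rate_mul_natCast hn]
        congr 1
        ring
      rw [h1, div_le_iff₀ (by positivity)] at htail
      rw [hz, le_div_iff₀ (by positivity)]
      rw [mul_div_assoc', mul_div_assoc', div_le_iff₀ hn0]
      calc 7 * (2 * ((C₂ + 2) * b) ^ 2) = 7 * (2 * (C₂ + 2) ^ 2) * b ^ 2 := by ring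
        _ ≤ n * b ^ 2 * κ₀ ^ 2 * b ^ 2 := by gcongr
        _ = _ := by ring
    rw [neg_div, Real.exp_neg, ← one_div]
    exact one_div_le_one_div_of_le (by norm_num) (by linarith [Real.add_one_le_exp z])

/-- Chaining at radius `d τ`, truncated at `a r`: the rates are balanced so that both the remainder
and the chaining sum are of order `r`. -/
lemma exists_dominating_of_empEntropy_rate (hn : 3 ≤ n) {F : Set (𝒳 → ℝ)} {f₁ : 𝒳 → ℝ}
    {p β s a d C₃ C₄ : ℝ} (hp : 2 < p) (hβ : 0 ≤ β) (hC₃ : 0 < C₃) (ha : 0 < a) (hd : 0 < d)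
    (hda : d ≤ a) (hdC₄ : d ≤ C₄)
    (hδt : rate n (-1 / (2 * p)) (β / p + s) ≤ d / a)
    (ht1 : rate n (-1 / (2 * p)) (-β / p - 3 * s) ≤ 1 / d)
    (hδn : 1 / a ≤ rate n (1 - 1 / p) (-2 * s))
    (hent : ∀ ε t : ℝ, a * rate n (-1 / p) (-2 * s) ≤ ε → ε ≤ t →
      t ≤ C₄ * rate n (-1 / (2 * p)) (-β / p - 3 * s) →
      empEntropy x ε (empBall x F f₁ t) ≤
        ((C₃ * (Real.sqrt n * Real.log n ^ (p * s) * Real.log (1 / ε) ^ β * (t / ε) ^ p) : ℝ) :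
          EReal)) :
    ∃ Z : (Fin n → ℝ) → ℝ, Integrable Z (stdNormal n) ∧
      (∀ g, ∀ f ∈ empBall x F f₁ (d * rate n (-1 / (2 * p)) (-β / p - 3 * s)),
        empPairing x g (f - f₁) ≤ Z g) ∧
      ∫ g, Z g ∂(stdNormal n) ≤
        (2 * a + 6 * (2 ^ (p / 2 - 1) / (2 ^ (p / 2 - 1) - 1)) * (Real.sqrt C₃ * d)) *
          rate n (-1 / p) (-2 * s) := by
  have hp0 : p ≠ 0 := by linarith
  have hn1 : (1 : ℝ) < n := by exact_mod_cast (by omega : 1 < n)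
  have hL := Real.log_pos hn1
  set r : ℝ := rate n (-1 / p) (-2 * s) with hr
  have hr0 : 0 < r := rate_pos hn _ _
  set τ : ℝ := rate n (-1 / (2 * p)) (-β / p - 3 * s) with hτ
  have hτ0 : 0 < τ := rate_pos hn _ _
  have hrτ : r = rate n (-1 / (2 * p)) (β / p + s) * τ := by
    rw [hr, hτ, rate_mul hn]
    congr 1
    · field_simp
      norm_num
    · ring
  have hle : a * r ≤ d * τ := by
    rw [hrτ]
    rw [le_div_iff₀ ha] at hδt
    nlinarith
  have hdτ : d * τ ≤ 1 := by
    rw [le_div_iff₀ hd] at ht1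
    linarith
  -- Hence `1/ε ≤ n` at all scales used, and `log (1/ε)` can be replaced by `log n`.
  have harn : 1 ≤ a * r * n := by
    have h1 : rate n (1 - 1 / p) (-2 * s) = r * n := by
      rw [hr, rate_mul_natCast hn]
      congr 1
      ring
    rw [h1, div_le_iff₀ ha] at hδn
    linarith
  have har : 0 < a * r := by positivity
  set Q : ℝ := C₃ * (Real.sqrt n * Real.log n ^ (p * s) * Real.log n ^ β) with hQ
  have hQ0 : 0 < Q := by
    have := Real.sqrt_pos.2 (zero_lt_one.trans hn1)
    positivity
  obtain ⟨Z, hZi, hZ, hZb⟩ := exists_dominating_of_empEntropy_le x (by omega) (F := F) (f₁ := f₁)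
    hp har hle hQ0 (fun ε h1 h2 => by
      refine (hent ε (d * τ) h1 h2 (by gcongr)).trans ?_
      rw [EReal.coe_le_coe_iff, hQ]
      have hε : 0 < ε := har.trans_le h1
      have h3 : 0 ≤ Real.log (1 / ε) :=
        Real.log_nonneg ((one_le_div hε).2 (h2.trans hdτ))
      have h4 : Real.log (1 / ε) ≤ Real.log n := by
        refine Real.log_le_log (by positivity) ((div_le_iff₀ hε).2 ?_)
        nlinarith
      calc _ ≤ C₃ * (Real.sqrt n * Real.log n ^ (p * s) * Real.log n ^ β * (d * τ / ε) ^ p) := by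
            gcongr
        _ = _ := by ring)
  refine ⟨Z, hZi, hZ, hZb.trans ?_⟩
  have hρ : (1 : ℝ) < 2 ^ (p / 2 - 1) := Real.one_lt_rpow one_lt_two (by linarith)
  have hρ' : (0 : ℝ) < 2 ^ (p / 2 - 1) - 1 := by linarith
  have hmain : Real.sqrt (Q / n) * (d * τ) * (d * τ / (a * r)) ^ (p / 2 - 1) ≤
      Real.sqrt C₃ * d * r := by
    have h1 : Q / n = C₃ * rate n (-1 / 4) ((p * s + β) / 2) ^ 2 := by
      have h2 : Real.sqrt n / n = rate n (-1 / 2) 0 := by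
        rw [rate, Real.rpow_zero, mul_one, Real.sqrt_div_self', Real.sqrt_eq_rpow, neg_div,
          Real.rpow_neg (by positivity), one_div]
      have h3 : Real.log n ^ (p * s) * Real.log n ^ β = rate n 0 (p * s + β) := by
        rw [rate, Real.rpow_zero, one_mul, Real.rpow_add hL]
      calc Q / n = C₃ * ((Real.sqrt n / n) * (Real.log n ^ (p * s) * Real.log n ^ β)) := by
            rw [hQ]
            ring
        _ = _ := by
            rw [h2, h3, sq, rate_mul hn, rate_mul hn]
            congr 2
            · norm_num
            · ring
    have h4 : d * τ / (a * r) = d / a * (τ * r⁻¹) := by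
      field_simp
    -- This keeps `a` out of the chaining constant, so that a small `d` makes it small.
    have h5 : (d / a) ^ (p / 2 - 1) ≤ 1 :=
      Real.rpow_le_one (by positivity) ((div_le_one ha).2 hda) (by linarith)
    have h6 : rate n (-1 / 4) ((p * s + β) / 2) * τ * (τ * r⁻¹) ^ (p / 2 - 1) = r := by
      rw [hτ, hr, rate_inv hn, rate_mul hn, rate_mul hn, rate_rpow hn, rate_mul hn]
      congr 1
      · field_simp
        ring
      · field_simp
        ring
    rw [h1, Real.sqrt_mul hC₃.le, Real.sqrt_sq (rate_pos hn _ _).le, h4,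
      Real.mul_rpow (by positivity) (by positivity)]
    calc _ = Real.sqrt C₃ * d * (d / a) ^ (p / 2 - 1) *
          (rate n (-1 / 4) ((p * s + β) / 2) * τ * (τ * r⁻¹) ^ (p / 2 - 1)) := by ring
      _ = Real.sqrt C₃ * d * r * (d / a) ^ (p / 2 - 1) := by
          rw [h6]
          ring
      _ ≤ Real.sqrt C₃ * d * r := mul_le_of_le_one_right (by positivity) h5
  calc _ ≤ 2 * (a * r) + 6 * (2 ^ (p / 2 - 1) / (2 ^ (p / 2 - 1) - 1)) *
        (Real.sqrt C₃ * d * r) := by gcongr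
    _ = _ := by ring

end Main

theorem theorem1 (p : ℝ) (hp : 2 < p)
    (c₁ C₁ C₂ C₃ C₄ : ℝ) (hc₁ : 0 < c₁) (hC₁ : 0 < C₁) (hC₂ : 0 < C₂) (hC₃ : 0 < C₃)
    (hC₄ : 0 < C₄) :
    ∃ a c : ℝ, 0 < a ∧ 0 < c ∧
      ∀ β γ ε₀ : ℝ, 0 ≤ β → 0 ≤ γ → 0 < ε₀ →
      ∃ n₀ : ℕ, ∀ n : ℕ, n₀ ≤ n →
      ∀ (𝒳 : Type*) (x : Fin n → 𝒳) (F : Set (𝒳 → ℝ)) (fhat : (Fin n → ℝ) → (𝒳 → ℝ)),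
        Convex ℝ F →
        IsLeastSquaresEstimator x F fhat →
        ∀ f₀ ∈ F, ∀ f₁ ∈ F,
          -- local entropy at `f₀`
          (∀ ε : ℝ, C₁ * rate n (-1 / p) γ ≤ ε → ε ≤ ε₀ →
            ((c₁ * ε ^ (-p) : ℝ) : EReal) ≤ empEntropy x ε (empBall x F f₀ (2 * ε))) →
          -- `f₁` is close to `f₀`
          empNorm x (f₁ - f₀) ≤ C₂ * rate n (-1 / (2 * p)) (-sExp p γ) →
          -- the neighbourhood of `f₁` is simple: entropy bound, or Gaussian width bound
          ((∀ ε t : ℝ, a * rate n (-1 / p) (-2 * sExp p γ) ≤ ε → ε ≤ t →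
              t ≤ C₄ * rate n (-1 / (2 * p)) (-β / p - 3 * sExp p γ) →
              empEntropy x ε (empBall x F f₁ t) ≤
                ((C₃ * (Real.sqrt n * Real.log n ^ (p * sExp p γ) * Real.log (1 / ε) ^ β *
                  (t / ε) ^ p) : ℝ) : EReal)) ∨
            (∃ t : ℝ, 0 < t ∧ t ≤ a * rate n (-1 / (2 * p)) (-β / p - 3 * sExp p γ) ∧
              gaussianWidth x (empBall x F f₁ t) ≤
                C₃ * rate n (-1 / (2 * p)) (β / p + sExp p γ) * t)) →
          ENNReal.ofReal (c * rate n (-1 / p) (-2 * β / p - 6 * sExp p γ)) ≤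
            worstCaseRisk x F fhat := by
  have hp0 : 0 < p := by linarith
  set κ₀ : ℝ := Real.sqrt (c₁ / 2) / 8 * C₁ ^ (1 - p / 2) with hκ₀
  have hκ₀0 : 0 < κ₀ := by
    have := Real.sqrt_pos.2 (half_pos hc₁)
    positivity
  -- With this `l` the penalty takes at most half of the gain `l κ₀ r`, which leaves `κ r`.
  set l : ℝ := min 1 (κ₀ / (C₂ + 2) ^ 2) with hl
  have hl0 : 0 < l := lt_min one_pos (by positivity)
  have hlκ : l * (C₂ + 2) ^ 2 ≤ κ₀ := (le_div_iff₀ (by positivity)).1 (min_le_right _ _)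
  set κ : ℝ := l * κ₀ / 2 with hκ
  have hκ0 : 0 < κ := by positivity
  -- The first bound makes the chaining remainder `2a r` at most `κ r / 8`; the second puts the
  -- radius of the width hypothesis below the target `κ / (4C₃) · τ`.
  set a : ℝ := min (κ / 16) (κ / (4 * C₃)) with ha
  have ha0 : 0 < a := lt_min (by positivity) (by positivity)
  set M : ℝ := 6 * (2 ^ (p / 2 - 1) / (2 ^ (p / 2 - 1) - 1)) * Real.sqrt C₃ with hM
  have hM0 : 0 < M := by
    have h1 : (1 : ℝ) < 2 ^ (p / 2 - 1) := Real.one_lt_rpow one_lt_two (by linarith)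
    have h2 : (0 : ℝ) < 2 ^ (p / 2 - 1) - 1 := by linarith
    have := Real.sqrt_pos.2 hC₃
    positivity
  set d : ℝ := min (min a C₄) (κ / (8 * M)) with hd
  have hd0 : 0 < d := lt_min (lt_min ha0 hC₄) (by positivity)
  have hda : d ≤ a := (min_le_left _ _).trans (min_le_left _ _)
  have hMd : M * d ≤ κ / 8 := by
    have h1 : d ≤ κ / (8 * M) := min_le_right _ _
    rw [le_div_iff₀ (by positivity)] at h1
    linarith
  -- All constants are fixed before `β`, `γ`, `ε₀`, which influence only the threshold on `n`.
  refine ⟨a, d ^ 2 / 2, ha0, by positivity, fun β γ ε₀ hβ _ hε₀ => ?_⟩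
  set s : ℝ := sExp p γ with hs
  have hneg1 : -1 / p < 0 := div_neg_of_neg_of_pos (by norm_num) hp0
  have hneg2 : -1 / (2 * p) < 0 := div_neg_of_neg_of_pos (by norm_num) (by positivity)
  have hpos : 0 < 1 - 1 / p := by
    rw [sub_pos, div_lt_one hp0]
    linarith
  refine Filter.eventually_atTop.1 ?_
  filter_upwards [Filter.eventually_ge_atTop 3,
    eventually_rate_le hneg1 γ (div_pos hε₀ hC₁),
    eventually_rate_le hneg2 (γ + s) (one_div_pos.2 hC₁),
    eventually_le_rate one_pos (-(γ * p)) (64 / (c₁ / 2 * C₁ ^ (-p))),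
    eventually_le_rate hpos (-2 * s) (7 * (2 * (C₂ + 2) ^ 2) / κ₀ ^ 2),
    eventually_rate_le hneg2 (β / p + s) (div_pos hd0 ha0),
    eventually_rate_le hneg2 (-β / p - 3 * s) (one_div_pos.2 hd0),
    eventually_le_rate hpos (-2 * s) (1 / a)] with n hn e1 e2 e3 e4 e5 e6 e7
  intro 𝒳 x F fhat hF hfhat f₀ _ f₁ hf₁ hent hdist hsimple
  obtain ⟨A, hA, hAp, hAf⟩ := exists_event_large_pairing_rate x hn hp hc₁ hC₁ hC₂ e1 e2 e3 e4
    hent hdist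
  set r : ℝ := rate n (-1 / p) (-2 * s) with hr
  have hr0 : 0 < r := rate_pos hn _ _
  set τ : ℝ := rate n (-1 / (2 * p)) (-β / p - 3 * s) with hτ
  have hτ0 : 0 < τ := rate_pos hn _ _
  have hτsq : rate n (-1 / p) (-2 * β / p - 6 * s) = τ ^ 2 := by
    rw [hτ, sq, rate_mul hn]
    congr 1
    · field_simp
      norm_num
    · ring
  have hobj : κ * r ≤ l * (κ₀ * r) -
      (l * ((C₂ + 2) * rate n (-1 / (2 * p)) (-s))) ^ 2 / 2 := by
    have h1 : rate n (-1 / (2 * p)) (-s) ^ 2 = r := by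
      rw [hr, sq, rate_mul hn]
      congr 1
      · field_simp
        norm_num
      · ring
    rw [mul_pow, mul_pow, h1, hκ]
    have h2 : l * r * (l * (C₂ + 2) ^ 2) ≤ l * r * κ₀ := by gcongr
    linarith
  -- The entropy alternative uses `u = d`, the width alternative `u = κ / (4C₃)`.
  suffices h : ∃ u, d ≤ u ∧ ∃ Z : (Fin n → ℝ) → ℝ, Integrable Z (stdNormal n) ∧
      (∀ g, ∀ f ∈ empBall x F f₁ (u * τ), empPairing x g (f - f₁) ≤ Z g) ∧
      ∫ g, Z g ∂(stdNormal n) ≤ κ * r / 4 by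
    obtain ⟨u, hdu, Z, hZi, hZ, hZb⟩ := h
    have hu0 : 0 < u := hd0.trans_le hdu
    refine le_trans (ENNReal.ofReal_le_ofReal ?_) (le_worstCaseRisk x hF hfhat hf₁
      (mul_pos hu0 hτ0) hl0.le (min_le_left _ _) (mul_pos hκ0 hr0) hobj hA hAp hAf hZi hZ hZb)
    rw [hτsq, mul_pow, div_mul_eq_mul_div]
    gcongr
  rcases hsimple with h | ⟨t, ht0, hta, hW⟩
  · obtain ⟨Z, hZi, hZ, hZb⟩ := exists_dominating_of_empEntropy_rate x hn hp hβ hC₃ ha0 hd0 hda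
      ((min_le_left _ _).trans (min_le_right _ _)) e5 e6 e7 h
    refine ⟨d, le_rfl, Z, hZi, hZ, hZb.trans ?_⟩
    have h1 : a ≤ κ / 16 := min_le_left _ _
    calc _ = (2 * a + M * d) * r := by
          rw [hM]
          ring
      _ ≤ (2 * (κ / 16) + κ / 8) * r := by gcongr
      _ = _ := by ring
  · have h1 : a ≤ κ / (4 * C₃) := min_le_right _ _
    have h2 : t ≤ κ / (4 * C₃) * τ := hta.trans (by gcongr)
    obtain ⟨Z, hZi, hZ, hZb⟩ := exists_dominating_of_gaussianWidth_le x hF hf₁ ht0 h2 hW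
    refine ⟨κ / (4 * C₃), hda.trans h1, Z, hZi, hZ, hZb.trans ?_⟩
    have h3 : rate n (-1 / (2 * p)) (β / p + s) * τ = r := by
      rw [hτ, hr, rate_mul hn]
      congr 1
      · field_simp
        norm_num
      · ring
    calc _ = C₃ * (κ / (4 * C₃)) * (rate n (-1 / (2 * p)) (β / p + s) * τ) := by ring
      _ = κ * r / 4 := by
          rw [h3]
          field_simp
      _ ≤ _ := le_rfl
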